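/- Let $M$ be a smooth $n$-dimensional manifold without boundary with a smooth Riemannian metric $g$, let $f\in C^\infty(M)$, and suppose that $(M,g,f)$ is an expanding gradient soliton, i.e. that $X=\nabla f$ satisfies $2\,\mathrm{Ric}+g=\mathscr L_X(g)$. Let $D$ be the Levi-Civita connection, and let $\Delta=-\nabla^*\nabla$ be the rough (connection) Laplacian on tensor fields. For a $(0,2)$-tensor field $h$ define the Lichnerowicz Laplacian, with respect to any orthonormal frame $\{e_1,\dots,e_n\}$, by $$(\Delta_L h)(e_i,e_k)=(\Delta h)(e_i,e_k)+2\sum_{j,l=1}^n R(e_i,e_j,e_k,e_l)\,h(e_j,e_l)-h(\mathrm{Ric}(e_i),e_k)-h(e_i,\mathrm{Ric}(e_k)),$$ where the curvature tensor has the sign for which $R(e_1,e_2,e_1,e_2)$ is the sectional curvature of the plane spanned by $e_1,e_2$. Then $$\Delta X+D_XX-\tfrac12X=0\quad\text{on }M,$$ and the tensor field $2\,\mathrm{Ric}+g=\mathscr L_X(g)$ satisfies $$\Delta_L(2\,\mathrm{Ric}+g)+\mathscr L_X(2\,\mathrm{Ric}+g)-(2\,\mathrm{Ric}+g)=0\quad\text{on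 }M.$$ -/

import Mathlib

open scoped Manifold ContDiff

noncomputable section

namespace RicciSoliton

/-! ## Tensor calculus in local coordinates

All tensor fields of this part live on (an open subset of) `ℝⁿ`, and are given by their
component functions with respect to the coordinate frame `∂₁, …, ∂ₙ`.  Throughout, `G i j`
are the components `g_{ij} = g(∂ᵢ, ∂ⱼ)` of a Riemannian metric. -/

section Coordinates

variable {n : ℕ}

/-- Components `Xⁱ` of a vector field in coordinates. -/
abbrev Vec (n : ℕ) : Type := Fin n → EuclideanSpace ℝ (Fin n) → ℝ

/-- Components `h_{ij}` of a `(0,2)`-tensor field in coordinates. -/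
abbrev Ten2 (n : ℕ) : Type := Fin n → Fin n → EuclideanSpace ℝ (Fin n) → ℝ

/-- Components of a tensor field with three indices in coordinates. -/
abbrev Ten3 (n : ℕ) : Type := Fin n → Fin n → Fin n → EuclideanSpace ℝ (Fin n) → ℝ

/-- The partial derivative `∂ᵢ u`. -/
def pd (i : Fin n) (u : EuclideanSpace ℝ (Fin n) → ℝ) (y : EuclideanSpace ℝ (Fin n)) : ℝ :=
  fderiv ℝ u y (EuclideanSpace.single i (1 : ℝ))

/-- The components `g^{ij}` of the inverse metric. -/
def invMetric (G : Ten2 n) : Ten2 n :=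
  fun i j y => (Matrix.of fun a b : Fin n => G a b y)⁻¹ i j

/-- The Christoffel symbols of the Levi-Civita connection, `christoffel G k i j = Γᵏ_{ij}`,
so that `∇_{∂ᵢ} ∂ⱼ = Γᵏ_{ij} ∂ₖ`:
`Γᵏ_{ij} = ½ g^{kl} (∂ᵢ g_{jl} + ∂ⱼ g_{il} - ∂ₗ g_{ij})`. -/
def christoffel (G : Ten2 n) : Ten3 n := fun k i j y =>
  (1 / 2 : ℝ) * ∑ l, invMetric G k l y * (pd i (G j l) y + pd j (G i l) y - pd l (G i j) y)

/-- The curvature tensor `R(∂ᵢ, ∂ⱼ) ∂ₖ = (curvature G l i j k) ∂ₗ`, where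
`R(U, V) W = ∇_U ∇_V W - ∇_V ∇_U W - ∇_{[U,V]} W`. -/
def curvature (G : Ten2 n) (l i j k : Fin n) (y : EuclideanSpace ℝ (Fin n)) : ℝ :=
  pd i (christoffel G l j k) y - pd j (christoffel G l i k) y
    + ∑ m, (christoffel G l i m y * christoffel G m j k y
      - christoffel G l j m y * christoffel G m i k y)

/-- The `(0,4)` curvature tensor with the sign convention that `R(e₁, e₂, e₁, e₂)` is the sectional
curvature of an orthonormal pair: `R_{ijkl} = g(R(∂ᵢ, ∂ⱼ) ∂ₗ, ∂ₖ)`. -/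
def riemann (G : Ten2 n) (i j k l : Fin n) (y : EuclideanSpace ℝ (Fin n)) : ℝ :=
  ∑ m, G k m y * curvature G m i j l y

/-- The Ricci tensor, `Ric(V, W) = trace (U ↦ R(U, V) W)`. -/
def ricci (G : Ten2 n) : Ten2 n := fun j k y => ∑ i, curvature G i i j k y

/-- Covariant derivative of a vector field: `covVec G X a i = ∇ₐ Xⁱ = (∇_{∂ₐ} X)ⁱ`. -/
def covVec (G : Ten2 n) (X : Vec n) : Ten2 n := fun a i y =>
  pd a (X i) y + ∑ m, christoffel G i a m y * X m y

/-- Covariant derivative of a tensor field `A a i = Aₐⁱ`, covariant in `a` and contravariant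
in `i`: `covTen11 G A b a i = ∇_b Aₐⁱ`. -/
def covTen11 (G : Ten2 n) (A : Ten2 n) : Ten3 n := fun b a i y =>
  pd b (A a i) y - (∑ m, christoffel G m b a y * A m i y) + ∑ m, christoffel G i b m y * A a m y

/-- Covariant derivative of a `(0,2)`-tensor field: `covTen2 G h a i j = ∇ₐ h_{ij}`. -/
def covTen2 (G : Ten2 n) (h : Ten2 n) : Ten3 n := fun a i j y =>
  pd a (h i j) y - (∑ m, christoffel G m a i y * h m j y) - ∑ m, christoffel G m a j y * h i m y

/-- Covariant derivative of a `(0,3)`-tensor field: `covTen3 G T b a i j = ∇_b T_{aij}`. -/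
def covTen3 (G : Ten2 n) (T : Ten3 n) (b a i j : Fin n) (y : EuclideanSpace ℝ (Fin n)) : ℝ :=
  pd b (T a i j) y - (∑ m, christoffel G m b a y * T m i j y)
    - (∑ m, christoffel G m b i y * T a m j y) - ∑ m, christoffel G m b j y * T a i m y

/-- The covariant derivative `D_W X` of the vector field `X` in the direction `W`. -/
def covAlong (G : Ten2 n) (W X : Vec n) : Vec n := fun i y => ∑ a, W a y * covVec G X a i y

/-- The rough (connection) Laplacian of a vector field, `(ΔX)ⁱ = g^{ab} ∇_b ∇ₐ Xⁱ`. -/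
def laplaceVec (G : Ten2 n) (X : Vec n) : Vec n := fun i y =>
  ∑ a, ∑ b, invMetric G a b y * covTen11 G (covVec G X) b a i y

/-- The rough (connection) Laplacian of a `(0,2)`-tensor field, `(Δh)_{ij} = g^{ab} ∇_b ∇ₐ h_{ij}`.
-/
def laplaceTen2 (G : Ten2 n) (h : Ten2 n) : Ten2 n := fun i j y =>
  ∑ a, ∑ b, invMetric G a b y * covTen3 G (covTen2 G h) b a i j y

/-- The Lichnerowicz Laplacian
`(Δ_L h)(∂ᵢ, ∂ₖ) = (Δh)(∂ᵢ, ∂ₖ) + 2 ∑ R(∂ᵢ, e_p, ∂ₖ, e_q) h(e_p, e_q)`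
`- h(Ric(∂ᵢ), ∂ₖ) - h(∂ᵢ, Ric(∂ₖ))`, where the sum over an orthonormal frame is written as a double
contraction with the inverse metric, and `Ric(∂ᵢ) = Ric_{ia} g^{ab} ∂_b`. -/
def lichnerowicz (G : Ten2 n) (h : Ten2 n) : Ten2 n := fun i k y =>
  laplaceTen2 G h i k y
    + 2 * (∑ a, ∑ b, ∑ c, ∑ d,
        invMetric G a c y * invMetric G b d y * riemann G i a k b y * h c d y)
    - (∑ a, ∑ b, ricci G i a y * invMetric G a b y * h b k y)
    - ∑ a, ∑ b, ricci G k a y * invMetric G a b y * h i b y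

/-- The Lie derivative of a `(0,2)`-tensor field,
`(𝓛_X h)_{ij} = Xᵃ ∂ₐ h_{ij} + h_{aj} ∂ᵢ Xᵃ + h_{ia} ∂ⱼ Xᵃ`. -/
def lieDeriv (X : Vec n) (h : Ten2 n) : Ten2 n := fun i j y =>
  ∑ a, (X a y * pd a (h i j) y + h a j y * pd i (X a) y + h i a y * pd j (X a) y)

/-- The gradient vector field of a function, `(∇u)ⁱ = g^{ij} ∂ⱼ u`. -/
def grad (G : Ten2 n) (u : EuclideanSpace ℝ (Fin n) → ℝ) : Vec n := fun i y =>
  ∑ j, invMetric G i j y * pd j u y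

end Coordinates

/-! ## Riemannian manifolds in charts -/

section Manifold

variable {n : ℕ} {M : Type*} [TopologicalSpace M] [ChartedSpace (EuclideanSpace ℝ (Fin n)) M]

/-- The coordinate vector field `∂ᵢ` of the chart `φ`, at the point with coordinates `y`. -/
def coordVec (φ : OpenPartialHomeomorph M (EuclideanSpace ℝ (Fin n))) (i : Fin n)
    (y : EuclideanSpace ℝ (Fin n)) : TangentSpace (𝓡 n) (φ.symm y) :=
  mfderiv (𝓡 n) (𝓡 n) φ.symm y (EuclideanSpace.single i (1 : ℝ) : EuclideanSpace ℝ (Fin n))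

variable [IsManifold (𝓡 n) ∞ M]

/-- The components `g_{ij} = g(∂ᵢ, ∂ⱼ)` of a Riemannian metric in the chart `φ`. -/
def metricIn (g : Bundle.ContMDiffRiemannianMetric (𝓡 n) ∞ (EuclideanSpace ℝ (Fin n))
      (fun x : M => TangentSpace (𝓡 n) x))
    (φ : OpenPartialHomeomorph M (EuclideanSpace ℝ (Fin n))) : Ten2 n :=
  fun i j y => g.inner (φ.symm y) (coordVec φ i y) (coordVec φ j y)

/-- The components of `X = ∇f` in the chart `φ`. -/
def gradIn (g : Bundle.ContMDiffRiemannianMetric (𝓡 n) ∞ (EuclideanSpace ℝ (Fin n))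
      (fun x : M => TangentSpace (𝓡 n) x))
    (f : M → ℝ) (φ : OpenPartialHomeomorph M (EuclideanSpace ℝ (Fin n))) : Vec n :=
  grad (metricIn g φ) (f ∘ φ.symm)

/-- The components of the `(0,2)`-tensor field `2 Ric + g` in the chart `φ`. -/
def twoRicAddMetricIn (g : Bundle.ContMDiffRiemannianMetric (𝓡 n) ∞ (EuclideanSpace ℝ (Fin n))
      (fun x : M => TangentSpace (𝓡 n) x))
    (φ : OpenPartialHomeomorph M (EuclideanSpace ℝ (Fin n))) : Ten2 n :=
  fun i j y => 2 * ricci (metricIn g φ) i j y + metricIn g φ i j y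

/-- `(M, g, f)` is an expanding gradient soliton: `f` is smooth and `2 Ric + g = 𝓛_{∇f} g`, an
equation of tensor fields, i.e. of components in every smooth chart. -/
structure IsExpandingGradientSoliton
    (g : Bundle.ContMDiffRiemannianMetric (𝓡 n) ∞ (EuclideanSpace ℝ (Fin n))
      (fun x : M => TangentSpace (𝓡 n) x))
    (f : M → ℝ) : Prop where
  smooth : ContMDiff (𝓡 n) 𝓘(ℝ, ℝ) ∞ f
  soliton_eq : ∀ φ ∈ IsManifold.maximalAtlas (𝓡 n) ∞ M, ∀ y ∈ φ.target, ∀ i j : Fin n,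
    twoRicAddMetricIn g φ i j y = lieDeriv (gradIn g f φ) (metricIn g φ) i j y

end Manifold

end RicciSoliton

end

noncomputable section

set_option linter.unusedSectionVars false

namespace RicciSoliton

/-! ## Tensor calculus over a commutative algebra with commuting derivations

The index set `ι` labels the coordinate frame, `d a` plays the role of `∂ₐ`, and the connection is
given by the matrices `Γ a` with entries `Γ a k j = Γᵏ_{aj}`. -/

namespace Formal

open Matrix

variable {ι A : Type*} [Fintype ι] [DecidableEq ι] [CommRing A] [Algebra ℝ A]

/-! In a chart, tensor components lie in the commutative algebra of smooth functions on the chart's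
target, where partial derivatives are commuting derivations. Both identities are therefore proved
algebraically, in `Formal.soliton_identities`, for any ℝ-algebra with commuting derivations, a
torsion-free connection and a parallel, symmetric, invertible `g`. The relation `Rep` carries the
result back to functions.

Write H for the Hessian of f and X = ∇f. Since the Lie derivative of g along X is 2H (`lie_metric`),
the soliton equation says Ric = H - g/2, and so ∇Ric = ∇H. The contracted Bianchi identity becomes
d(tr H) = 2 div H, while commuting derivatives gives div H - d(tr H) = Ric(X). Together they give
div H = -Ric(X) (`div2_hess`). Raising the index, ΔX = -Ric(X), whereas D_X X = H(X) = Ric(X) + X/2;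
this is the first identity.

For the second, derivatives in ΔH are commuted (`cov3_hess_comm`, `cov3_comm`) until ∇ div H
appears. The terms of curvature times H cancel the zeroth-order terms of Δ_L, up to one Ric∘H, and
the terms with ∇R reduce to ∇Ric = ∇H. What remains is Δ_L H = -∇_X H - 2 Ric∘H (`lich_hess`). The
Lie derivative of H along X is ∇_X H + 2 H∘H, and Ric∘H = H∘H - H/2, so the two add up to H. The
claim follows from 2 Ric + g = 2H by additivity. -/

lemma map_derivation_mul (D : Derivation ℝ A A) (M N : Matrix ι ι A) :
    (M * N).map D = M.map D * N + M * N.map D := by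
  ext i j
  simp [Matrix.mul_apply, Matrix.add_apply, Finset.sum_add_distrib, mul_comm, add_comm]

lemma map_derivation_add (D : Derivation ℝ A A) (M N : Matrix ι ι A) :
    (M + N).map D = M.map D + N.map D := by
  ext i j; simp

lemma map_derivation_sub (D : Derivation ℝ A A) (M N : Matrix ι ι A) :
    (M - N).map D = M.map D - N.map D := by
  ext i j; simp

lemma map_derivation_one (D : Derivation ℝ A A) :
    (1 : Matrix ι ι A).map D = 0 := by
  ext i j; by_cases h : i = j <;> simp [h]

/-! ### Connection, curvature and Laplacians in matrix form. -/

variable (d : ι → Derivation ℝ A A) (Γ : ι → Matrix ι ι A)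

/-- The curvature endomorphism `R(∂ₐ, ∂_b)`. -/
def curv (a b : ι) : Matrix ι ι A :=
  (Γ b).map (d a) - (Γ a).map (d b) + (Γ a * Γ b - Γ b * Γ a)

/-- The Ricci tensor. -/
def ric : Matrix ι ι A := Matrix.of fun j k => ∑ i, curv d Γ i j i k

/-- Covariant derivative of a covector field. -/
def cov1 (x : ι → A) (a : ι) : ι → A := fun i => d a (x i) - (x ᵥ* Γ a) i

/-- Covariant derivative of a `(0,2)`-tensor field. -/
def cov2 (h : Matrix ι ι A) (a : ι) : Matrix ι ι A :=
  h.map (d a) - (Γ a)ᵀ * h - h * Γ a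

/-- Covariant derivative of a `(0,3)`-tensor field. -/
def cov3 (T : ι → Matrix ι ι A) (b a : ι) : Matrix ι ι A :=
  cov2 d Γ (T a) b - ∑ m, Γ b m a • T m

/-- Covariant derivative of a `(0,4)`-tensor field. -/
def cov4 (P : ι → ι → Matrix ι ι A) (c a b : ι) : Matrix ι ι A :=
  cov2 d Γ (P a b) c - (∑ m, Γ c m a • P m b) - ∑ m, Γ c m b • P a m

/-- Covariant derivative of the curvature tensor. -/
def covCurv (c a b : ι) : Matrix ι ι A :=
  (curv d Γ a b).map (d c) + (Γ c * curv d Γ a b - curv d Γ a b * Γ c)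
    - (∑ m, Γ c m a • curv d Γ m b) - ∑ m, Γ c m b • curv d Γ a m

/-- Covariant derivative of a vector field, `covV X a i = ∇ₐ Xⁱ`. -/
def covV (X : ι → A) : Matrix ι ι A := Matrix.of fun a i => d a (X i) + (Γ a *ᵥ X) i

/-- Covariant derivative of a `(1,1)`-tensor field. -/
def cov11 (B : Matrix ι ι A) (b : ι) : Matrix ι ι A :=
  B.map (d b) - (Γ b)ᵀ * B + B * (Γ b)ᵀ

/-- The Lie derivative of a `(0,2)`-tensor field. -/
def lie (X : ι → A) (h : Matrix ι ι A) : Matrix ι ι A := Matrix.of fun i j =>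
  ∑ a, (X a * d a (h i j) + h a j * d i (X a) + h i a * d j (X a))

/-- The rough Laplacian of a `(0,2)`-tensor field. -/
def lap2 (gi : Matrix ι ι A) (h : Matrix ι ι A) : Matrix ι ι A :=
  ∑ a, ∑ b, gi a b • cov3 d Γ (cov2 d Γ h) b a

/-- The rough Laplacian of a vector field. -/
def lapV (gi : Matrix ι ι A) (X : ι → A) : ι → A := fun i =>
  ∑ a, ∑ b, gi a b * cov11 d Γ (covV d Γ X) b a i

/-- The zeroth order curvature term `R(∂ᵢ, e_p, ∂ₖ, e_q) h(e_p, e_q)`. -/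
def curvTerm (g gi : Matrix ι ι A) (h : Matrix ι ι A) : Matrix ι ι A := Matrix.of fun i k =>
  ∑ a, ∑ b, ∑ c, ∑ e, gi a c * gi b e * (g * curv d Γ i a) k b * h c e

/-- The Lichnerowicz Laplacian. -/
def lich (g gi : Matrix ι ι A) (h : Matrix ι ι A) : Matrix ι ι A :=
  lap2 d Γ gi h + (2 : A) • curvTerm d Γ g gi h - ric d Γ * gi * h - h * (ric d Γ * gi)ᵀ

variable {d Γ}

/-! ### Ricci identities and the two Bianchi identities. -/

lemma curv_antisymm (a b : ι) : curv d Γ a b = -curv d Γ b a := by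
  unfold curv; abel

lemma cov2_add (h k : Matrix ι ι A) (a : ι) :
    cov2 d Γ (h + k) a = cov2 d Γ h a + cov2 d Γ k a := by
  simp only [cov2, map_derivation_add, mul_add, add_mul]; abel

lemma cov2_sub (h k : Matrix ι ι A) (a : ι) :
    cov2 d Γ (h - k) a = cov2 d Γ h a - cov2 d Γ k a := by
  simp only [cov2, map_derivation_sub, mul_sub, sub_mul]; abel

lemma cov2_smul (c : ℝ) (h : Matrix ι ι A) (a : ι) :
    cov2 d Γ (c • h) a = c • cov2 d Γ h a := by
  have : (c • h).map (d a) = c • h.map (d a) := by ext; simp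
  simp only [cov2, this, smul_sub, Matrix.mul_smul, Matrix.smul_mul]

lemma cov3_add (S T : ι → Matrix ι ι A) (b a : ι) :
    cov3 d Γ (S + T) b a = cov3 d Γ S b a + cov3 d Γ T b a := by
  simp only [cov3, Pi.add_apply, cov2_add, smul_add, Finset.sum_add_distrib]; abel

lemma cov2_transpose (h : Matrix ι ι A) (a : ι) :
    cov2 d Γ hᵀ a = (cov2 d Γ h a)ᵀ := by
  simp only [cov2, transpose_sub, transpose_mul, transpose_transpose]
  have : (h.map (d a))ᵀ = hᵀ.map (d a) := rfl
  rw [this]; abel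

lemma cov2_apply (h : Matrix ι ι A) (a i j : ι) :
    cov2 d Γ h a i j
      = d a (h i j) - (∑ m, Γ a m i * h m j) - ∑ m, Γ a m j * h i m := by
  simp [cov2, Matrix.mul_apply, mul_comm]

lemma cov3_apply (T : ι → Matrix ι ι A) (b a i j : ι) :
    cov3 d Γ T b a i j
      = d b (T a i j) - (∑ m, Γ b m a * T m i j) - (∑ m, Γ b m i * T a m j)
        - ∑ m, Γ b m j * T a i m := by
  simp only [cov3, cov2_apply, Matrix.sub_apply, Matrix.sum_apply, Matrix.smul_apply, smul_eq_mul]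
  ring

lemma cov4_apply (P : ι → ι → Matrix ι ι A) (c a b i j : ι) :
    cov4 d Γ P c a b i j
      = d c (P a b i j) - (∑ m, Γ c m a * P m b i j) - (∑ m, Γ c m b * P a m i j)
        - (∑ m, Γ c m i * P a b m j) - ∑ m, Γ c m j * P a b i m := by
  simp only [cov4, cov2_apply, Matrix.sub_apply, Matrix.sum_apply, Matrix.smul_apply, smul_eq_mul]
  ring

/-- The Ricci identity for the commutator of `∇ₐ` and `∇_b` along coordinate fields. -/
lemma cov2_comm (hd : ∀ a b u, d a (d b u) = d b (d a u)) (h : Matrix ι ι A) (a b : ι) :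
    cov2 d Γ (cov2 d Γ h b) a - cov2 d Γ (cov2 d Γ h a) b
      = -((curv d Γ a b)ᵀ * h + h * curv d Γ a b) := by
  have h1 : (h.map (d b)).map (d a) = (h.map (d a)).map (d b) := by
    ext i j; simp [hd a b]
  have h2 (c e : ι) : ((Γ c)ᵀ).map (d e) = ((Γ c).map (d e))ᵀ := rfl
  simp only [cov2, curv, map_derivation_sub, map_derivation_mul, h1, h2, transpose_sub,
    transpose_add, transpose_mul]
  noncomm_ring

/-- The Ricci identity for `(0,2)`-tensor fields. -/
lemma cov3_comm (hd : ∀ a b u, d a (d b u) = d b (d a u)) (ht : ∀ a b k, Γ a k b = Γ b k a)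
    (h : Matrix ι ι A) (a b : ι) :
    cov3 d Γ (cov2 d Γ h) a b - cov3 d Γ (cov2 d Γ h) b a
      = -((curv d Γ a b)ᵀ * h + h * curv d Γ a b) := by
  rw [← cov2_comm hd, cov3, cov3]
  simp only [ht a b]
  abel

/-- The Ricci identity for covector fields. -/
lemma cov1_comm (hd : ∀ a b u, d a (d b u) = d b (d a u)) (x : ι → A) (a b : ι) :
    cov1 d Γ (cov1 d Γ x b) a - cov1 d Γ (cov1 d Γ x a) b = -(x ᵥ* curv d Γ a b) := by
  have h1 (a b i : ι) : d a ((x ᵥ* Γ b) i)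
      = ((fun m => d a (x m)) ᵥ* Γ b) i + (x ᵥ* (Γ b).map (d a)) i := by
    simp [Matrix.vecMul, dotProduct, Finset.sum_add_distrib, mul_comm]
  have h2 (a b : ι) : cov1 d Γ x b ᵥ* Γ a
      = (fun m => d b (x m)) ᵥ* Γ a - x ᵥ* (Γ b * Γ a) := by
    rw [← vecMul_vecMul, ← sub_vecMul]; rfl
  ext i
  rw [Pi.sub_apply]
  simp only [cov1, map_sub, h1]
  have e1 := congrFun (h2 a b) i
  have e2 := congrFun (h2 b a) i
  simp only [Pi.sub_apply] at e1 e2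
  simp only [curv, Pi.neg_apply, vecMul_add, vecMul_sub, Pi.add_apply, Pi.sub_apply, e1, e2,
    hd a b]
  ring

/-- The first Bianchi identity. -/
lemma curv_bianchi_first (ht : ∀ a b k, Γ a k b = Γ b k a) (a b c l : ι) :
    curv d Γ a b l c + curv d Γ b c l a + curv d Γ c a l b = 0 := by
  simp only [curv, Matrix.add_apply, Matrix.sub_apply, Matrix.map_apply, Matrix.mul_apply]
  simp only [ht c b, ht c a, ht b a]
  ring

/-- The second Bianchi identity. -/
lemma covCurv_bianchi (hd : ∀ a b u, d a (d b u) = d b (d a u))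
    (ht : ∀ a b k, Γ a k b = Γ b k a) (a b c : ι) :
    covCurv d Γ c a b + covCurv d Γ a b c + covCurv d Γ b c a = 0 := by
  have h1 (M : Matrix ι ι A) (a b : ι) : (M.map (d b)).map (d a) = (M.map (d a)).map (d b) := by
    ext i j; simp [hd a b]
  -- By torsion-freeness, the corrections on the two form indices cancel in pairs around the cyclic
  -- sum.
  have h2 (c a b : ι) : ∑ m, Γ c m a • curv d Γ m b = - ∑ m, Γ a m c • curv d Γ b m := by
    rw [← Finset.sum_neg_distrib]
    refine Finset.sum_congr rfl fun m _ => ?_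
    rw [curv_antisymm m b, ht c a, smul_neg]
  -- The rest is the Jacobi identity for the operators `d a + Γ a`, whose commutators are the
  -- curvature.
  have key (c a b : ι) : (curv d Γ a b).map (d c) + (Γ c * curv d Γ a b - curv d Γ a b * Γ c)
      + ((curv d Γ b c).map (d a) + (Γ a * curv d Γ b c - curv d Γ b c * Γ a))
      + ((curv d Γ c a).map (d b) + (Γ b * curv d Γ c a - curv d Γ c a * Γ b)) = 0 := by
    simp only [curv, map_derivation_sub, map_derivation_add, map_derivation_mul, h1 _ b a,
      h1 _ c a, h1 _ c b]
    noncomm_ring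
  unfold covCurv
  rw [h2 c a b, h2 a b c, h2 b c a, ← key c a b]
  abel

/-! ### Symmetries of the curvature of a parallel metric. -/

variable {g gi : Matrix ι ι A}

lemma eq_of_two_mul_eq {a b : A} (h : 2 * a = 2 * b) : a = b := by
  have h2 : algebraMap ℝ A (1 / 2) * 2 = 1 := by
    rw [← map_ofNat (algebraMap ℝ A) 2, ← map_mul]; norm_num
  linear_combination algebraMap ℝ A (1 / 2) * h + (b - a) * h2

/-- The curvature endomorphisms are skew-adjoint with respect to a parallel form. -/
lemma curv_skew (hd : ∀ a b u, d a (d b u) = d b (d a u)) (hg : ∀ a, cov2 d Γ g a = 0) (a b : ι) :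
    (curv d Γ a b)ᵀ * g = -(g * curv d Γ a b) := by
  have h0 : cov2 d Γ (0 : Matrix ι ι A) = 0 := by
    funext a; ext i j; simp [cov2_apply]
  have := cov2_comm (Γ := Γ) hd g a b
  rw [hg a, hg b, h0] at this
  simp only [Pi.zero_apply, sub_zero] at this
  rw [eq_neg_iff_add_eq_zero, ← neg_eq_zero, ← this]

variable (d Γ g) in
/-- The curvature tensor with all indices lowered. -/
def lowCurv (a b : ι) : Matrix ι ι A := g * curv d Γ a b

lemma lowCurv_antisymm (a b k l : ι) : lowCurv d Γ g a b k l = -lowCurv d Γ g b a k l := by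
  rw [lowCurv, lowCurv, curv_antisymm, mul_neg, Matrix.neg_apply]

/-- Skew-adjointness of the curvature endomorphism, read off in components using the symmetry of
`g`. -/
lemma lowCurv_skew (hd : ∀ a b u, d a (d b u) = d b (d a u)) (hs : gᵀ = g)
    (hg : ∀ a, cov2 d Γ g a = 0) (a b k l : ι) :
    lowCurv d Γ g a b k l = -lowCurv d Γ g a b l k := by
  have h := congrFun (congrFun (curv_skew hd hg a b) l) k
  have h2 : (curv d Γ a b)ᵀ * g = (g * curv d Γ a b)ᵀ := by rw [transpose_mul, hs]
  rw [h2] at h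
  simpa [lowCurv] using h

lemma lowCurv_bianchi (ht : ∀ a b k, Γ a k b = Γ b k a) (a b c k : ι) :
    lowCurv d Γ g a b k c + lowCurv d Γ g b c k a + lowCurv d Γ g c a k b = 0 := by
  simp only [lowCurv, Matrix.mul_apply, ← Finset.sum_add_distrib, ← mul_add,
    curv_bianchi_first ht, mul_zero, Finset.sum_const_zero]

/-- The pair symmetry of the curvature tensor. -/
lemma lowCurv_pair (hd : ∀ a b u, d a (d b u) = d b (d a u)) (ht : ∀ a b k, Γ a k b = Γ b k a)
    (hs : gᵀ = g) (hg : ∀ a, cov2 d Γ g a = 0) (a b k l : ι) :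
    lowCurv d Γ g a b k l = lowCurv d Γ g k l a b := by
  have S := lowCurv_skew hd hs hg
  have T := lowCurv_antisymm (d := d) (Γ := Γ) (g := g)
  have B := lowCurv_bianchi (d := d) (g := g) ht
  apply eq_of_two_mul_eq
  -- Four instances of the first Bianchi identity. Once the skew symmetries have normalised the
  -- terms, the alternating sum leaves only twice the difference of the two sides.
  have b1 := B a b l k
  have b2 := B a b k l
  have b3 := B k l a b
  have b4 := B k l b a
  rw [S b l k a, T l a k b, S a l k b] at b1
  rw [S a b l k, S b k l a, T k a l b, S a k l b] at b2
  rw [S k l b a, T l a b k] at b3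
  rw [T l b a k] at b4
  linear_combination b1 - b2 + b3 - b4

/-- Lowering an index commutes with covariant differentiation. -/
lemma cov4_lowCurv (hg : ∀ a, cov2 d Γ g a = 0) (c a b : ι) :
    cov4 d Γ (lowCurv d Γ g) c a b = g * covCurv d Γ c a b := by
  have h := hg c
  rw [cov2, sub_sub, sub_eq_zero] at h
  simp only [cov4, cov2, lowCurv, covCurv, map_derivation_mul, h, mul_sub, mul_add,
    Finset.mul_sum, Matrix.mul_smul]
  noncomm_ring

/-- As `g` is parallel, lowering an index commutes with ∇ (`cov4_lowCurv`), so ∇R inherits the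
algebraic symmetries of R. The same reason gives `covCurv_pair`. -/
lemma covCurv_skew (hd : ∀ a b u, d a (d b u) = d b (d a u)) (hs : gᵀ = g)
    (hg : ∀ a, cov2 d Γ g a = 0) (c a b : ι) :
    (covCurv d Γ c a b)ᵀ * g = -(g * covCurv d Γ c a b) := by
  have : (covCurv d Γ c a b)ᵀ * g = (g * covCurv d Γ c a b)ᵀ := by rw [transpose_mul, hs]
  rw [this, ← cov4_lowCurv hg]
  ext i j
  have S := lowCurv_skew hd hs hg
  simp only [transpose_apply, Matrix.neg_apply, cov4_apply]
  rw [S a b j i, map_neg]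
  simp only [S a b _ i, S _ b j i, S a _ j i, S a b j _, mul_neg, Finset.sum_neg_distrib]
  ring

lemma covCurv_antisymm (c a b : ι) : covCurv d Γ c a b = -covCurv d Γ c b a := by
  have h1 (m : ι) : curv d Γ m b = -curv d Γ b m := curv_antisymm _ _
  have h2 (m : ι) : curv d Γ a m = -curv d Γ m a := curv_antisymm _ _
  have h3 (M : Matrix ι ι A) : (-M).map (d c) = -M.map (d c) := by ext i j; simp
  unfold covCurv
  simp only [h1, h2, smul_neg, Finset.sum_neg_distrib, h3, mul_neg, neg_mul]
  abel

lemma covCurv_pair (hd : ∀ a b u, d a (d b u) = d b (d a u)) (ht : ∀ a b k, Γ a k b = Γ b k a)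
    (hs : gᵀ = g) (hg : ∀ a, cov2 d Γ g a = 0) (c a b k l : ι) :
    (g * covCurv d Γ c a b) k l = (g * covCurv d Γ c k l) a b := by
  rw [← cov4_lowCurv hg, ← cov4_lowCurv hg]
  have S := lowCurv_pair hd ht hs hg
  simp only [cov4_apply]
  rw [S a b k l]
  simp only [S _ b k l, S a _ k l, S a b _ l, S a b k _]
  ring

/-- Contracting an index of the curvature commutes with covariant differentiation. -/
lemma sum_covCurv_eq_cov2_ric (c b k : ι) :
    ∑ i, covCurv d Γ c i b i k = cov2 d Γ (ric d Γ) c b k := by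
  simp only [covCurv, cov2_apply, ric, Matrix.of_apply, Matrix.sub_apply, Matrix.add_apply,
    Matrix.sum_apply, Matrix.smul_apply, smul_eq_mul, Matrix.map_apply, Matrix.mul_apply, map_sum,
    Finset.sum_add_distrib, Finset.sum_sub_distrib, Finset.mul_sum]
  rw [Finset.sum_comm (f := fun i m => Γ c i m * curv d Γ i b m k),
    Finset.sum_comm (f := fun i m => curv d Γ i b i m * Γ c m k),
    Finset.sum_comm (f := fun i m => Γ c m b * curv d Γ i m i k)]
  simp only [mul_comm (curv d Γ _ b _ _)]
  rw [sub_right_comm]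
  abel

/-- A single trace of the second Bianchi identity: two of its three terms become derivatives of
Ricci. -/
lemma sum_covCurv_divergence (hd : ∀ a b u, d a (d b u) = d b (d a u))
    (ht : ∀ a b k, Γ a k b = Γ b k a) (b c k : ι) :
    ∑ i, covCurv d Γ i b c i k = cov2 d Γ (ric d Γ) b c k - cov2 d Γ (ric d Γ) c b k := by
  rw [← sum_covCurv_eq_cov2_ric, ← sum_covCurv_eq_cov2_ric, ← Finset.sum_sub_distrib]
  refine Finset.sum_congr rfl fun i _ => ?_
  have h := congrFun (congrFun (covCurv_bianchi hd ht i b c) i) k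
  rw [covCurv_antisymm b c i] at h
  simp only [Matrix.add_apply, Matrix.neg_apply, Matrix.zero_apply] at h
  linear_combination h

/-! ### Contractions with the inverse metric. -/

lemma skew_inv {M : Matrix ι ι A} (h1 : g * gi = 1) (h2 : gi * g = 1) (hM : Mᵀ * g = -(g * M)) :
    M * gi = -(gi * Mᵀ) := by
  calc M * gi = gi * (g * M) * gi := by rw [← mul_assoc, h2, one_mul]
    _ = -(gi * Mᵀ * (g * gi)) := by rw [← neg_eq_iff_eq_neg.mpr hM]; noncomm_ring
    _ = _ := by rw [h1, mul_one]

lemma skew_inv_apply {M : Matrix ι ι A} (h1 : g * gi = 1) (h2 : gi * g = 1)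
    (hM : Mᵀ * g = -(g * M)) (i k : ι) : ∑ m, M i m * gi m k = -∑ m, gi i m * M k m := by
  simpa [Matrix.mul_apply] using congrFun (congrFun (skew_inv h1 h2 hM) i) k

lemma inv_symm (h1 : g * gi = 1) (hs : gᵀ = g) : giᵀ = gi := by
  have : giᵀ * g = 1 := by rw [← hs, ← transpose_mul, h1, transpose_one]
  calc giᵀ = giᵀ * (g * gi) := by rw [h1, mul_one]
    _ = gi := by rw [← mul_assoc, this, one_mul]

/-- The inverse metric is parallel. -/
lemma map_inv (h1 : g * gi = 1) (h2 : gi * g = 1) (hg : ∀ a, cov2 d Γ g a = 0) (c : ι) :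
    gi.map (d c) = -(Γ c * gi + gi * (Γ c)ᵀ) := by
  have h := hg c
  rw [cov2, sub_sub, sub_eq_zero] at h
  -- Differentiate `g * gi = 1` and solve for the derivative of `gi`, with `d c` of `g` given by
  -- parallelism.
  have h3 := map_derivation_one (ι := ι) (d c)
  rw [← h1, map_derivation_mul, h] at h3
  calc gi.map (d c) = gi * (g * gi.map (d c)) := by rw [← mul_assoc, h2, one_mul]
    _ = -(gi * (Γ c)ᵀ * (g * gi) + gi * g * Γ c * gi) := by
      rw [eq_neg_of_add_eq_zero_right h3]; noncomm_ring
    _ = _ := by rw [h1, h2]; noncomm_ring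

/-- Metric contraction commutes with covariant differentiation. -/
lemma sum_inv_mul_cov2 (h1 : g * gi = 1) (h2 : gi * g = 1) (hs : gᵀ = g)
    (hg : ∀ a, cov2 d Γ g a = 0) (S : Matrix ι ι A) (c : ι) :
    ∑ a, ∑ b, gi a b * cov2 d Γ S c a b = d c (∑ a, ∑ b, gi a b * S a b) := by
  have hgi := inv_symm h1 hs
  have tr (M : Matrix ι ι A) : ∑ a, ∑ b, gi a b * M a b = trace (gi * M) := by
    rw [Finset.sum_comm]
    simp only [trace, diag_apply, Matrix.mul_apply]
    refine Finset.sum_congr rfl fun a _ => Finset.sum_congr rfl fun b _ => ?_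
    rw [← congrFun (congrFun hgi a) b, transpose_apply]
  have dtr (M : Matrix ι ι A) : d c (trace M) = trace (M.map (d c)) := by simp [trace]
  rw [tr, tr, dtr, map_derivation_mul, map_inv h1 h2 hg, cov2]
  have e : trace (gi * (S * Γ c)) = trace (Γ c * gi * S) := by
    rw [← mul_assoc, trace_mul_comm, mul_assoc]
  simp only [mul_sub, trace_sub, e, add_mul, neg_mul, trace_add, trace_neg, neg_add, mul_assoc]
  ring

variable (d Γ gi) in
/-- The divergence of a `(0,2)`-tensor field. -/
def div2 (h : Matrix ι ι A) (j : ι) : A := ∑ a, ∑ b, gi a b * cov2 d Γ h b a j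

/-- The contracted second Bianchi identity. -/
lemma contracted_bianchi (hd : ∀ a b u, d a (d b u) = d b (d a u))
    (ht : ∀ a b k, Γ a k b = Γ b k a) (h1 : g * gi = 1) (h2 : gi * g = 1) (hs : gᵀ = g)
    (hg : ∀ a, cov2 d Γ g a = 0) (c : ι) :
    ∑ a, ∑ b, gi a b * cov2 d Γ (ric d Γ) c a b
      = 2 * ∑ a, ∑ b, gi a b * cov2 d Γ (ric d Γ) a c b := by
  have hgi (a b : ι) : gi a b = gi b a := congrFun (congrFun (inv_symm h1 hs) b) a
  -- A second trace: skewness of ∇R with respect to the metric turns the divergence of R into minus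
  -- the divergence of Ricci.
  have key : ∑ b, ∑ k, gi b k * ∑ i, covCurv d Γ i b c i k
      = -∑ i, ∑ k, gi i k * cov2 d Γ (ric d Γ) i c k := by
    calc ∑ b, ∑ k, gi b k * ∑ i, covCurv d Γ i b c i k
        = ∑ b, ∑ i, ∑ k, covCurv d Γ i b c i k * gi k b := by
          refine Finset.sum_congr rfl fun b _ => ?_
          simp only [Finset.mul_sum]
          rw [Finset.sum_comm]
          simp only [hgi b, mul_comm]
      _ = -∑ b, ∑ i, ∑ k, gi i k * covCurv d Γ i b c b k := by
          simp only [skew_inv_apply h1 h2 (covCurv_skew hd hs hg _ _ _), Finset.sum_neg_distrib]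
      _ = _ := by
          rw [Finset.sum_comm]
          simp only [← sum_covCurv_eq_cov2_ric, Finset.mul_sum]
          refine congrArg _ (Finset.sum_congr rfl fun i _ => Finset.sum_comm)
  simp only [sum_covCurv_divergence hd ht, mul_sub, Finset.sum_sub_distrib] at key
  linear_combination -key

/-- The second derivative commutator for the differential of a function. -/
lemma cov2_hess_comm (hd : ∀ a b u, d a (d b u) = d b (d a u)) (ht : ∀ a b k, Γ a k b = Γ b k a)
    (x : ι → A) (H : Matrix ι ι A) (hH : ∀ a, H a = cov1 d Γ x a) (a b i : ι) :
    cov2 d Γ H a b i - cov2 d Γ H b a i = -(x ᵥ* curv d Γ a b) i := by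
  have h (a b i : ι) : cov2 d Γ H a b i
      = cov1 d Γ (cov1 d Γ x b) a i - ∑ m, Γ a m b * H m i := by
    rw [cov2_apply, cov1, ← hH]
    simp only [Matrix.vecMul, dotProduct, mul_comm]
    ring
  rw [h, h, ← Pi.neg_apply, ← cov1_comm hd, Pi.sub_apply]
  simp only [ht a b]
  ring

/-- Skewness moves `N` across the metric onto the raised vector. For `N` built from curvature
endomorphisms, this produces the term Ric(X) in `div2_hess`. -/
lemma sum_skew_vec {x : ι → A} {N : ι → Matrix ι ι A} {r : ι → A}
    (h1 : g * gi = 1) (h2 : gi * g = 1) (hs : gᵀ = g)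
    (hN : ∀ b, (N b)ᵀ * g = -(g * N b)) (hr : ∀ k, ∑ b, N b b k = r k) :
    ∑ a, ∑ b, gi a b * (x ᵥ* N a) b = -∑ k, r k * (gi *ᵥ x) k := by
  have hgi := inv_symm h1 hs
  have e (a : ι) : ∑ b, gi a b * (x ᵥ* N a) b = -∑ k, N a a k * (gi *ᵥ x) k := by
    calc ∑ b, gi a b * (x ᵥ* N a) b = (gi *ᵥ (x ᵥ* N a)) a := rfl
      _ = (x ᵥ* (N a * gi)) a := by rw [← vecMul_vecMul, ← vecMul_transpose, hgi]
      _ = -(N a *ᵥ (gi *ᵥ x)) a := by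
        rw [skew_inv h1 h2 (hN a), vecMul_neg, Pi.neg_apply, ← vecMul_vecMul, vecMul_transpose,
          ← vecMul_transpose gi, hgi]
  simp only [e, Finset.sum_neg_distrib, ← hr, Finset.sum_mul]
  rw [Finset.sum_comm]

/-! ### The Hessian, raising of indices and Lie derivatives. -/

variable (d Γ) in
/-- The covariant derivative of a covector field as a `(0,2)`-tensor field. -/
def hess (x : ι → A) : Matrix ι ι A := Matrix.of fun a => cov1 d Γ x a

lemma hess_symm (hd : ∀ a b u, d a (d b u) = d b (d a u)) (ht : ∀ a b k, Γ a k b = Γ b k a)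
    (f : A) : (hess d Γ fun i => d i f)ᵀ = hess d Γ fun i => d i f := by
  ext a b
  simp [hess, cov1, hd a b, Matrix.vecMul, dotProduct, ht a b]

lemma cov2_symm {H : Matrix ι ι A} (hH : Hᵀ = H) (a i j : ι) :
    cov2 d Γ H a i j = cov2 d Γ H a j i := by
  conv_lhs => rw [← hH, cov2_transpose]
  rfl

lemma derivation_mulVec (D : Derivation ℝ A A) (M : Matrix ι ι A) (x : ι → A) (i : ι) :
    D ((M *ᵥ x) i) = (M.map D *ᵥ x) i + (M *ᵥ fun m => D (x m)) i := by
  simp [Matrix.mulVec, dotProduct, Finset.sum_add_distrib, mul_comm, add_comm]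

lemma derivation_vecMul (D : Derivation ℝ A A) (M : Matrix ι ι A) (x : ι → A) (i : ι) :
    D ((x ᵥ* M) i) = ((fun m => D (x m)) ᵥ* M) i + (x ᵥ* M.map D) i := by
  simp [Matrix.vecMul, dotProduct, Finset.sum_add_distrib, mul_comm]

/-- The inverse metric is parallel, so raising an index commutes with ∇; `cov11_raise` is the
analogue one order higher. -/
lemma covV_raise (h1 : g * gi = 1) (h2 : gi * g = 1) (hs : gᵀ = g) (hg : ∀ a, cov2 d Γ g a = 0)
    (x : ι → A) : covV d Γ (gi *ᵥ x) = hess d Γ x * gi := by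
  have hgi := inv_symm h1 hs
  ext a i
  have e : (hess d Γ x * gi) a i = (gi *ᵥ cov1 d Γ x a) i := by
    rw [← vecMul_transpose, hgi]; rfl
  have e2 : cov1 d Γ x a = (fun m => d a (x m)) - (Γ a)ᵀ *ᵥ x := by
    rw [mulVec_transpose]; rfl
  rw [e, e2, covV, Matrix.of_apply, derivation_mulVec, map_inv h1 h2 hg]
  simp only [mulVec_sub, neg_mulVec, add_mulVec, mulVec_mulVec, Pi.add_apply, Pi.sub_apply,
    Pi.neg_apply]
  ring

lemma cov11_raise (h1 : g * gi = 1) (h2 : gi * g = 1) (hg : ∀ a, cov2 d Γ g a = 0)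
    (H : Matrix ι ι A) (b : ι) : cov11 d Γ (H * gi) b = cov2 d Γ H b * gi := by
  rw [cov11, map_derivation_mul, map_inv h1 h2 hg, cov2]
  noncomm_ring

/-- The Lie derivative expressed through the covariant derivative. -/
lemma lie_eq (ht : ∀ a b k, Γ a k b = Γ b k a) (X : ι → A) (h : Matrix ι ι A) :
    lie d X h = (∑ a, X a • cov2 d Γ h a) + covV d Γ X * h + h * (covV d Γ X)ᵀ := by
  ext i j
  simp only [lie, covV, Matrix.of_apply, Matrix.add_apply, Matrix.sum_apply, Matrix.smul_apply,
    smul_eq_mul, cov2_apply, Matrix.mul_apply, transpose_apply, add_mul, mul_add, mul_sub,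
    Finset.sum_add_distrib, Finset.sum_sub_distrib, Matrix.mulVec, dotProduct, Finset.mul_sum,
    Finset.sum_mul]
  rw [Finset.sum_comm (f := fun a m => X a * (Γ a m i * h m j)),
    Finset.sum_comm (f := fun a m => X a * (Γ a m j * h i m))]
  have e1 : ∑ m, ∑ a, Γ i m a * X a * h m j = ∑ m, ∑ a, X a * (Γ a m i * h m j) :=
    Finset.sum_congr rfl fun m _ => Finset.sum_congr rfl fun a _ => by rw [ht i a]; ring
  have e2 : ∑ m, ∑ a, h i m * (Γ j m a * X a) = ∑ m, ∑ a, X a * (Γ a m j * h i m) :=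
    Finset.sum_congr rfl fun m _ => Finset.sum_congr rfl fun a _ => by rw [ht j a]; ring
  rw [e1, e2]
  simp only [mul_comm (h _ j)]
  ring

/-- `𝓛_{∇f} g = 2 ∇²f`. -/
lemma lie_metric (hd : ∀ a b u, d a (d b u) = d b (d a u)) (ht : ∀ a b k, Γ a k b = Γ b k a)
    (h1 : g * gi = 1) (h2 : gi * g = 1) (hs : gᵀ = g) (hg : ∀ a, cov2 d Γ g a = 0) (f : A) :
    lie d (gi *ᵥ fun i => d i f) g = hess d Γ (fun i => d i f) + hess d Γ (fun i => d i f) := by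
  rw [lie_eq (Γ := Γ) ht, covV_raise h1 h2 hs hg, transpose_mul, inv_symm h1 hs,
    hess_symm hd ht, mul_assoc, h2, ← mul_assoc, h1]
  simp [hg]

/-! ### Divergence of the Hessian and the first soliton identity. -/

lemma cov2_ric {x : ι → A} (hg : ∀ a, cov2 d Γ g a = 0)
    (hR : ric d Γ = hess d Γ x - (1 / 2 : ℝ) • g) (a : ι) :
    cov2 d Γ (ric d Γ) a = cov2 d Γ (hess d Γ x) a := by
  rw [hR, cov2_sub, cov2_smul, hg, smul_zero, sub_zero]

/-- On a soliton, `div ∇²f = -Ric(∇f)`. -/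
lemma div2_hess (hd : ∀ a b u, d a (d b u) = d b (d a u)) (ht : ∀ a b k, Γ a k b = Γ b k a)
    (h1 : g * gi = 1) (h2 : gi * g = 1) (hs : gᵀ = g) (hg : ∀ a, cov2 d Γ g a = 0) {x : ι → A}
    (hH : (hess d Γ x)ᵀ = hess d Γ x) (hR : ric d Γ = hess d Γ x - (1 / 2 : ℝ) • g) :
    div2 d Γ gi (hess d Γ x) = -(ric d Γ *ᵥ (gi *ᵥ x)) := by
  have hgi (a b : ι) : gi a b = gi b a := congrFun (congrFun (inv_symm h1 hs) b) a
  ext j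
  have B := contracted_bianchi hd ht h1 h2 hs hg j
  simp only [cov2_ric hg hR] at B
  have C : div2 d Γ gi (hess d Γ x) j
      = ∑ a, ∑ b, gi a b * cov2 d Γ (hess d Γ x) a j b := by
    rw [div2, Finset.sum_comm]
    refine Finset.sum_congr rfl fun a _ => Finset.sum_congr rfl fun b _ => ?_
    rw [hgi, cov2_symm hH]
  have D := sum_skew_vec (x := x) (N := fun a => curv d Γ j a) (r := fun k => -ric d Γ j k)
    h1 h2 hs (fun b => curv_skew hd hg _ _) fun k => by
      rw [ric, Matrix.of_apply, ← Finset.sum_neg_distrib]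
      exact Finset.sum_congr rfl fun b _ => by rw [curv_antisymm]; rfl
  -- The traced Ricci identity: the left side is div H - d(tr H), up to symmetry of H, and `D`
  -- evaluates it as Ric(X).
  have E : ∑ a, ∑ b, gi a b * (x ᵥ* curv d Γ j a) b
      = (∑ a, ∑ b, gi a b * cov2 d Γ (hess d Γ x) a j b)
        - ∑ a, ∑ b, gi a b * cov2 d Γ (hess d Γ x) j a b := by
    rw [← Finset.sum_sub_distrib]
    refine Finset.sum_congr rfl fun a _ => ?_
    rw [← Finset.sum_sub_distrib]
    refine Finset.sum_congr rfl fun b _ => ?_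
    have h := cov2_hess_comm hd ht x (hess d Γ x) (fun _ => rfl) j a b
    linear_combination gi a b * h
  have F : (ric d Γ *ᵥ (gi *ᵥ x)) j = ∑ k, ric d Γ j k * (gi *ᵥ x) k := rfl
  simp only [neg_mul, Finset.sum_neg_distrib] at D
  rw [Pi.neg_apply, F]
  linear_combination C - B + E - D

/-- `Δ∇f = -Ric(∇f)` on a soliton. -/
lemma lapV_grad (hd : ∀ a b u, d a (d b u) = d b (d a u)) (ht : ∀ a b k, Γ a k b = Γ b k a)
    (h1 : g * gi = 1) (h2 : gi * g = 1) (hs : gᵀ = g) (hg : ∀ a, cov2 d Γ g a = 0) {x : ι → A}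
    (hH : (hess d Γ x)ᵀ = hess d Γ x) (hR : ric d Γ = hess d Γ x - (1 / 2 : ℝ) • g) :
    lapV d Γ gi (gi *ᵥ x) = -(gi *ᵥ (ric d Γ *ᵥ (gi *ᵥ x))) := by
  rw [← mulVec_neg, ← div2_hess hd ht h1 h2 hs hg hH hR,
    ← vecMul_transpose gi (div2 _ _ _ _), inv_symm h1 hs]
  ext i
  simp only [lapV, covV_raise h1 h2 hs hg, cov11_raise h1 h2 hg, Matrix.vecMul, dotProduct, div2,
    Matrix.mul_apply, Finset.mul_sum, Finset.sum_mul]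
  conv_rhs => rw [Finset.sum_comm]
  refine Finset.sum_congr rfl fun a _ => ?_
  rw [Finset.sum_comm]
  simp only [mul_assoc]

/-- The first soliton identity. -/
lemma lapV_add_covAlong (hd : ∀ a b u, d a (d b u) = d b (d a u))
    (ht : ∀ a b k, Γ a k b = Γ b k a)
    (h1 : g * gi = 1) (h2 : gi * g = 1) (hs : gᵀ = g) (hg : ∀ a, cov2 d Γ g a = 0) {x : ι → A}
    (hH : (hess d Γ x)ᵀ = hess d Γ x) (hR : ric d Γ = hess d Γ x - (1 / 2 : ℝ) • g) :
    lapV d Γ gi (gi *ᵥ x) + (gi *ᵥ x) ᵥ* covV d Γ (gi *ᵥ x) - (1 / 2 : ℝ) • (gi *ᵥ x) = 0 := by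
  -- D_X X is H(X) with its index raised; substituting H = Ric + g/2 yields the Ricci term that
  -- cancels ΔX.
  have e : (gi *ᵥ x) ᵥ* (hess d Γ x * gi)
      = gi *ᵥ (ric d Γ *ᵥ (gi *ᵥ x)) + (1 / 2 : ℝ) • (gi *ᵥ x) := by
    have : hess d Γ x = ric d Γ + (1 / 2 : ℝ) • g := by rw [hR]; abel
    rw [← mulVec_transpose, transpose_mul, hH, inv_symm h1 hs, ← mulVec_mulVec, this, add_mulVec,
      smul_mulVec, mulVec_mulVec x g gi, h1, one_mulVec, mulVec_add, mulVec_smul]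
  rw [lapV_grad hd ht h1 h2 hs hg hH hR, covV_raise h1 h2 hs hg, e]
  abel

/-! ### The Lichnerowicz Laplacian of the Hessian and the second soliton identity. -/

/-- The covariant derivative of the identity `∇ₐ∇ᵢxⱼ - ∇ᵢ∇ₐxⱼ = -x(R(∂ₐ,∂ᵢ)∂ⱼ)`. -/
lemma cov3_hess_comm (hd : ∀ a b u, d a (d b u) = d b (d a u))
    (ht : ∀ a b k, Γ a k b = Γ b k a) (x : ι → A) (b a i j : ι) :
    cov3 d Γ (cov2 d Γ (hess d Γ x)) b a i j = cov3 d Γ (cov2 d Γ (hess d Γ x)) b i a j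
      - (x ᵥ* covCurv d Γ b a i) j - (hess d Γ x b ᵥ* curv d Γ a i) j := by
  have h (a i j : ι) : cov2 d Γ (hess d Γ x) a i j
      = cov2 d Γ (hess d Γ x) i a j - (x ᵥ* curv d Γ a i) j := by
    linear_combination cov2_hess_comm hd ht x (hess d Γ x) (fun _ => rfl) a i j
  have e1 : (fun m => d b (x m)) = hess d Γ x b + x ᵥ* Γ b := by
    ext m; simp [hess, cov1]
  have e2 : ∑ m, Γ b m j * (x ᵥ* curv d Γ a i) m = (x ᵥ* (curv d Γ a i * Γ b)) j := by
    rw [← vecMul_vecMul]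
    simp only [mul_comm (Γ b _ j)]
    rfl
  have e3 (c : ι → A) (N : ι → Matrix ι ι A) :
      (x ᵥ* ∑ m, c m • N m) j = ∑ m, c m * (x ᵥ* N m) j := by
    simp only [Matrix.vecMul, dotProduct, Matrix.sum_apply, Matrix.smul_apply, smul_eq_mul,
      Finset.mul_sum]
    rw [Finset.sum_comm]
    exact Finset.sum_congr rfl fun _ _ => Finset.sum_congr rfl fun _ _ => by ring
  simp only [cov3_apply]
  rw [h a i j, map_sub, derivation_vecMul, e1]
  simp only [h _ i j, h a _ j, h a i _, mul_sub, Finset.sum_sub_distrib, e2]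
  simp only [covCurv, vecMul_sub, vecMul_add, Pi.sub_apply, Pi.add_apply, e3, add_vecMul,
    vecMul_vecMul]
  ring

/-- The Leibniz rule for the contraction of a `(0,2)`-tensor field with a vector field. -/
lemma cov1_mulVec (h : Matrix ι ι A) (X : ι → A) (i j : ι) :
    cov1 d Γ (h *ᵥ X) i j = (cov2 d Γ h i *ᵥ X) j + (h *ᵥ covV d Γ X i) j := by
  have e : covV d Γ X i = (fun m => d i (X m)) + Γ i *ᵥ X := rfl
  rw [cov1, derivation_mulVec, e, cov2, ← mulVec_transpose]
  simp only [sub_mulVec, mulVec_add, mulVec_mulVec, Pi.sub_apply, Pi.add_apply]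
  ring

/-- Metric contraction of two indices of a `(0,3)`-tensor field commutes with covariant
differentiation. -/
lemma sum_inv_mul_cov3 (h1 : g * gi = 1) (h2 : gi * g = 1) (hs : gᵀ = g)
    (hg : ∀ a, cov2 d Γ g a = 0) (T : ι → Matrix ι ι A) (i j : ι) :
    ∑ a, ∑ b, gi a b * cov3 d Γ T i b a j
      = cov1 d Γ (fun j => ∑ a, ∑ b, gi a b * T b a j) i j := by
  have h := sum_inv_mul_cov2 h1 h2 hs hg (Matrix.of fun a b => T b a j) i
  simp only [Matrix.of_apply] at h
  have e : ((fun j => ∑ a, ∑ b, gi a b * T b a j) ᵥ* Γ i) j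
      = ∑ a, ∑ b, gi a b * ∑ m, Γ i m j * T b a m := by
    simp only [Matrix.vecMul, dotProduct, Finset.sum_mul, Finset.mul_sum]
    rw [Finset.sum_comm]
    refine Finset.sum_congr rfl fun a _ => ?_
    rw [Finset.sum_comm]
    exact Finset.sum_congr rfl fun b _ => Finset.sum_congr rfl fun m _ => by ring
  rw [cov1, ← h, e]
  simp only [← Finset.sum_sub_distrib, ← mul_sub]
  refine Finset.sum_congr rfl fun a _ => Finset.sum_congr rfl fun b _ => ?_
  rw [cov3_apply, cov2_apply]
  simp only [Matrix.of_apply]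
  ring

/-- The trace of the curvature operator acting on the first index. -/
lemma sum_inv_mul_curv (hd : ∀ a b u, d a (d b u) = d b (d a u))
    (h1 : g * gi = 1) (h2 : gi * g = 1) (hs : gᵀ = g) (hg : ∀ a, cov2 d Γ g a = 0)
    (h : Matrix ι ι A) (i j : ι) :
    ∑ a, ∑ b, gi a b * ((curv d Γ b i)ᵀ * h) a j = -(ric d Γ * gi * h) i j := by
  have hgi (a b : ι) : gi a b = gi b a := congrFun (congrFun (inv_symm h1 hs) b) a
  have e (b : ι) : ∑ a, gi a b * ((curv d Γ b i)ᵀ * h) a j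
      = -∑ m, curv d Γ b i b m * (gi * h) m j := by
    calc ∑ a, gi a b * ((curv d Γ b i)ᵀ * h) a j = (gi * ((curv d Γ b i)ᵀ * h)) b j := by
          rw [Matrix.mul_apply]; simp only [hgi b]
      _ = -(curv d Γ b i * (gi * h)) b j := by
          rw [← mul_assoc, ← mul_assoc, skew_inv h1 h2 (curv_skew hd hg b i), neg_mul,
            Matrix.neg_apply, neg_neg]
      _ = _ := by rw [Matrix.mul_apply]
  rw [Finset.sum_comm]
  simp only [e, Finset.sum_neg_distrib]
  rw [Finset.sum_comm, mul_assoc, Matrix.mul_apply]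
  simp only [ric, Matrix.of_apply, Finset.sum_mul]

/-- Skew-adjointness absorbs one inverse metric, which puts the term in the form produced by
commuting derivatives of the Hessian. -/
lemma curvTerm_eq (hd : ∀ a b u, d a (d b u) = d b (d a u))
    (h1 : g * gi = 1) (hg : ∀ a, cov2 d Γ g a = 0)
    (h : Matrix ι ι A) (i k : ι) :
    curvTerm d Γ g gi h i k = ∑ a, ∑ c, gi a c * (h c ᵥ* curv d Γ a i) k := by
  have e (a c : ι) : ∑ b, gi b c * (g * curv d Γ i a) k b = curv d Γ a i c k := by
    calc ∑ b, gi b c * (g * curv d Γ i a) k b = (g * curv d Γ i a * gi) k c := by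
          rw [Matrix.mul_apply]; simp only [mul_comm]
      _ = ((curv d Γ a i)ᵀ * (g * gi)) k c := by
          rw [← mul_assoc, curv_skew hd hg a i, curv_antisymm i a, mul_neg]
      _ = _ := by rw [h1, mul_one, transpose_apply]
  rw [curvTerm, Matrix.of_apply]
  refine Finset.sum_congr rfl fun a _ => ?_
  rw [Finset.sum_comm]
  refine Finset.sum_congr rfl fun c _ => ?_
  rw [Finset.sum_comm, Matrix.vecMul, dotProduct, Finset.mul_sum]
  refine Finset.sum_congr rfl fun m _ => ?_
  rw [← e, Finset.mul_sum, Finset.mul_sum]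
  exact Finset.sum_congr rfl fun b _ => by ring

/-- Pair symmetry of ∇R turns this contraction into a divergence of R, which the traced second
Bianchi identity expresses through ∇Ric. -/
lemma sum_vec_covCurv (hd : ∀ a b u, d a (d b u) = d b (d a u)) (ht : ∀ a b k, Γ a k b = Γ b k a)
    (h1 : g * gi = 1) (h2 : gi * g = 1) (hs : gᵀ = g) (hg : ∀ a, cov2 d Γ g a = 0) (x : ι → A)
    (i j : ι) :
    ∑ a, ∑ b, gi a b * (x ᵥ* covCurv d Γ b a i) j
      = ∑ k, (gi *ᵥ x) k * (cov2 d Γ (ric d Γ) k j i - cov2 d Γ (ric d Γ) j k i) := by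
  have hx (N : Matrix ι ι A) : x ᵥ* N = (gi *ᵥ x) ᵥ* (g * N) := by
    rw [← vecMul_vecMul, ← mulVec_transpose g, hs, mulVec_mulVec, h1, one_mulVec]
  have hgi (a b : ι) : gi a b = gi b a := congrFun (congrFun (inv_symm h1 hs) b) a
  have e (b k : ι) : ∑ a, gi a b * (g * covCurv d Γ b k j) a i = covCurv d Γ b k j b i := by
    calc ∑ a, gi a b * (g * covCurv d Γ b k j) a i = (gi * (g * covCurv d Γ b k j)) b i := by
          rw [Matrix.mul_apply]; simp only [hgi b]
      _ = _ := by rw [← mul_assoc, h2, one_mul]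
  simp only [hx, ← sum_covCurv_divergence hd ht, ← e]
  simp only [Matrix.vecMul, dotProduct, covCurv_pair hd ht hs hg _ _ i _ j, Finset.mul_sum]
  rw [Finset.sum_comm]
  conv_rhs => rw [Finset.sum_comm]
  refine Finset.sum_congr rfl fun b _ => ?_
  rw [Finset.sum_comm]
  exact Finset.sum_congr rfl fun b _ => Finset.sum_congr rfl fun b _ => by ring

/-- The Lichnerowicz Laplacian of the Hessian of the potential of a soliton. -/
lemma lich_hess (hd : ∀ a b u, d a (d b u) = d b (d a u)) (ht : ∀ a b k, Γ a k b = Γ b k a)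
    (h1 : g * gi = 1) (h2 : gi * g = 1) (hs : gᵀ = g) (hg : ∀ a, cov2 d Γ g a = 0) {x : ι → A}
    (hH : (hess d Γ x)ᵀ = hess d Γ x) (hR : ric d Γ = hess d Γ x - (1 / 2 : ℝ) • g) (i j : ι) :
    lich d Γ g gi (hess d Γ x) i j = -2 * (ric d Γ * gi * hess d Γ x) j i
      - ∑ k, (gi *ᵥ x) k * cov2 d Γ (hess d Γ x) k i j := by
  have hgi (a b : ι) : gi a b = gi b a := congrFun (congrFun (inv_symm h1 hs) b) a
  set H := hess d Γ x with hHdef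
  set X := gi *ᵥ x with hX
  -- Exchange a with i inside ∇H, then exchange the two outer derivatives; the leading term becomes
  -- ∇ᵢ of the divergence of H.
  have L : lap2 d Γ gi H i j = (∑ a, ∑ b, gi a b * cov3 d Γ (cov2 d Γ H) i b a j)
      - (∑ a, ∑ b, gi a b * ((curv d Γ b i)ᵀ * H) a j)
      - (∑ a, ∑ b, gi a b * (H * curv d Γ b i) a j)
      - (∑ a, ∑ b, gi a b * (x ᵥ* covCurv d Γ b a i) j)
      - (∑ a, ∑ b, gi a b * (H b ᵥ* curv d Γ a i) j) := by
    simp only [lap2, Matrix.sum_apply, Matrix.smul_apply, smul_eq_mul, ← Finset.sum_sub_distrib]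
    refine Finset.sum_congr rfl fun a _ => Finset.sum_congr rfl fun b _ => ?_
    have c1 := cov3_hess_comm hd ht x b a i j
    have c2 := congrFun (congrFun (cov3_comm hd ht H b i) a) j
    simp only [Matrix.sub_apply, Matrix.add_apply, Matrix.neg_apply] at c2
    linear_combination gi a b * c1 + gi a b * c2
  have S1 := sum_inv_mul_cov3 h1 h2 hs hg (cov2 d Γ H) i j
  have S1' : cov1 d Γ (fun j => ∑ a, ∑ b, gi a b * cov2 d Γ H b a j) i j
      = -(∑ k, X k * cov2 d Γ H i j k) - (ric d Γ * gi * H) j i := by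
    have e0 := div2_hess hd ht h1 h2 hs hg hH hR
    have e1 : (fun j => ∑ a, ∑ b, gi a b * cov2 d Γ H b a j) = -(ric d Γ *ᵥ X) := e0
    have e2 : (ric d Γ *ᵥ covV d Γ X i) j = (ric d Γ * gi * H) j i := by
      rw [hX, covV_raise h1 h2 hs hg, mul_assoc]
      have : gi * H = (H * gi)ᵀ := by rw [transpose_mul, hH, inv_symm h1 hs]
      rw [this]
      rfl
    have e3 := cov1_mulVec (d := d) (Γ := Γ) (ric d Γ) X i j
    have e4 : cov1 d Γ (-(ric d Γ *ᵥ X)) i j = -cov1 d Γ (ric d Γ *ᵥ X) i j := by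
      simp [cov1, neg_vecMul]; ring
    rw [e1, e4, e3, e2, cov2_ric hg hR]
    simp only [Matrix.mulVec, dotProduct, mul_comm]
    ring
  have S2 := sum_inv_mul_curv hd h1 h2 hs hg H i j
  have S3 : ∑ a, ∑ b, gi a b * (H * curv d Γ b i) a j
      = ∑ a, ∑ b, gi a b * (H b ᵥ* curv d Γ a i) j := by
    rw [Finset.sum_comm]
    refine Finset.sum_congr rfl fun a _ => Finset.sum_congr rfl fun b _ => ?_
    rw [hgi]; rfl
  have S4 := sum_vec_covCurv hd ht h1 h2 hs hg x i j
  simp only [cov2_ric hg hR, ← hHdef, ← hX] at S4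
  have S5 := curvTerm_eq hd h1 hg H i j
  -- By the Ricci identity this is the curvature of the pair i, j paired twice with X, which
  -- vanishes by skewness.
  have S6 : ∑ k, X k * (cov2 d Γ H i j k - cov2 d Γ H j i k) = 0 := by
    have c (k : ι) : cov2 d Γ H i j k - cov2 d Γ H j i k = -(x ᵥ* curv d Γ i j) k :=
      cov2_hess_comm hd ht x H (fun _ => rfl) i j k
    have q : X ⬝ᵥ (x ᵥ* curv d Γ i j) = -(X ⬝ᵥ (x ᵥ* curv d Γ i j)) := by
      have sk := skew_inv h1 h2 (curv_skew hd hg i j)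
      have tr : gi * (curv d Γ i j)ᵀ = (curv d Γ i j * gi)ᵀ := by
        rw [transpose_mul, inv_symm h1 hs]
      have e : X ⬝ᵥ (x ᵥ* curv d Γ i j) = x ⬝ᵥ ((curv d Γ i j * gi) *ᵥ x) := by
        rw [dotProduct_comm, ← dotProduct_mulVec, hX, mulVec_mulVec]
      rw [e]
      conv_lhs => rw [sk, tr, neg_mulVec, dotProduct_neg, mulVec_transpose, dotProduct_comm,
        ← dotProduct_mulVec]
    have z : X ⬝ᵥ (x ᵥ* curv d Γ i j) = 0 :=
      eq_of_two_mul_eq (by linear_combination q)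
    simp only [c, mul_neg, Finset.sum_neg_distrib]
    exact neg_eq_zero.mpr z
  have S7 : (H * (ric d Γ * gi)ᵀ) i j = (ric d Γ * gi * H) j i := by
    rw [← transpose_apply (ric d Γ * gi * H), transpose_mul (ric d Γ * gi) H, hH]
  simp only [lich, Matrix.sub_apply, Matrix.add_apply, Matrix.smul_apply, smul_eq_mul]
  rw [L, S1, S1', S2, S3, S4, S5, S7]
  simp only [mul_sub, Finset.sum_sub_distrib] at S6 ⊢
  simp only [fun k => cov2_symm (d := d) (Γ := Γ) hH k j i,
    fun k => cov2_symm (d := d) (Γ := Γ) hH j k i]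
  linear_combination -S6

/-- The second soliton identity, for the Hessian of the potential. -/
lemma lich_hess_add_lie (hd : ∀ a b u, d a (d b u) = d b (d a u))
    (ht : ∀ a b k, Γ a k b = Γ b k a)
    (h1 : g * gi = 1) (h2 : gi * g = 1) (hs : gᵀ = g) (hg : ∀ a, cov2 d Γ g a = 0) {x : ι → A}
    (hH : (hess d Γ x)ᵀ = hess d Γ x) (hR : ric d Γ = hess d Γ x - (1 / 2 : ℝ) • g) :
    lich d Γ g gi (hess d Γ x) + lie d (gi *ᵥ x) (hess d Γ x) - hess d Γ x = 0 := by
  have hgi := inv_symm h1 hs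
  have e1 : ric d Γ * gi * hess d Γ x
      = hess d Γ x * gi * hess d Γ x - (1 / 2 : ℝ) • hess d Γ x := by
    rw [hR, sub_mul, sub_mul, smul_mul_assoc, h1, smul_mul_assoc, one_mul]
  have e2 : (hess d Γ x * gi * hess d Γ x)ᵀ = hess d Γ x * gi * hess d Γ x := by
    rw [transpose_mul, transpose_mul, hH, hgi, mul_assoc]
  ext i j
  have e3 := congrFun (congrFun e2 i) j
  have e4 := congrFun (congrFun hH i) j
  -- Records 2 · ½ = 1 inside `A`, as the final ring computation needs it.
  have e5 := map_mul (algebraMap ℝ A) 2 (1 / 2)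
  rw [mul_one_div_cancel two_ne_zero, map_one, map_ofNat] at e5
  rw [transpose_apply] at e3 e4
  rw [Matrix.sub_apply, Matrix.add_apply, lich_hess hd ht h1 h2 hs hg hH hR, e1,
    lie_eq (Γ := Γ) ht, covV_raise h1 h2 hs hg, transpose_mul, hH, hgi, ← mul_assoc]
  simp only [Matrix.sub_apply, Matrix.add_apply, Matrix.smul_apply, Matrix.sum_apply, smul_eq_mul,
    Matrix.zero_apply, e3, e4]
  simp only [Algebra.smul_def]
  linear_combination -hess d Γ x i j * e5

lemma lich_add (h k : Matrix ι ι A) :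
    lich d Γ g gi (h + k) = lich d Γ g gi h + lich d Γ g gi k := by
  have e1 : lap2 d Γ gi (h + k) = lap2 d Γ gi h + lap2 d Γ gi k := by
    have : cov2 d Γ (h + k) = cov2 d Γ h + cov2 d Γ k := funext fun a => cov2_add h k a
    simp only [lap2, this, cov3_add, smul_add, Finset.sum_add_distrib]
  have e2 : curvTerm d Γ g gi (h + k) = curvTerm d Γ g gi h + curvTerm d Γ g gi k := by
    ext i j
    simp only [curvTerm, Matrix.of_apply, Matrix.add_apply, mul_add, Finset.sum_add_distrib]
  simp only [lich, e1, e2, smul_add, mul_add, add_mul]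
  abel

lemma lie_add (X : ι → A) (h k : Matrix ι ι A) : lie d X (h + k) = lie d X h + lie d X k := by
  ext i j
  simp only [lie, Matrix.of_apply, Matrix.add_apply, map_add, ← Finset.sum_add_distrib]
  exact Finset.sum_congr rfl fun _ _ => by ring

/-- The two soliton identities over an algebra with commuting derivations. -/
theorem soliton_identities (hd : ∀ a b u, d a (d b u) = d b (d a u))
    (ht : ∀ a b k, Γ a k b = Γ b k a)
    (h1 : g * gi = 1) (h2 : gi * g = 1) (hs : gᵀ = g) (hg : ∀ a, cov2 d Γ g a = 0) (f : A)
    (hsol : ric d Γ + ric d Γ + g = lie d (gi *ᵥ fun i => d i f) g) :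
    (lapV d Γ gi (gi *ᵥ fun i => d i f)
        + (gi *ᵥ fun i => d i f) ᵥ* covV d Γ (gi *ᵥ fun i => d i f)
        - (1 / 2 : ℝ) • (gi *ᵥ fun i => d i f) = 0) ∧
      lich d Γ g gi (ric d Γ + ric d Γ + g) + lie d (gi *ᵥ fun i => d i f) (ric d Γ + ric d Γ + g)
        - (ric d Γ + ric d Γ + g) = 0 := by
  have hH := hess_symm hd ht f
  rw [lie_metric hd ht h1 h2 hs hg] at hsol
  have hR : ric d Γ = hess d Γ (fun i => d i f) - (1 / 2 : ℝ) • g := by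
    have h := congrArg (fun M => (1 / 2 : ℝ) • M) hsol
    simp only [smul_add, ← add_smul, add_halves, one_smul] at h
    rw [← h, add_sub_cancel_right]
  refine ⟨lapV_add_covAlong hd ht h1 h2 hs hg hH hR, ?_⟩
  have h := lich_hess_add_lie hd ht h1 h2 hs hg hH hR
  rw [hsol, lich_add, lie_add]
  set H := hess d Γ fun i => d i f
  set X := gi *ᵥ fun i => d i f
  calc _ = (lich d Γ g gi H + lie d X H - H) + (lich d Γ g gi H + lie d X H - H) := by abel
    _ = 0 := by rw [h, add_zero]

end Formal

/-! ### The Levi-Civita connection is torsion-free and metric. -/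

namespace Formal
open Matrix

variable {ι A : Type*} [Fintype ι] [DecidableEq ι] [CommRing A] [Algebra ℝ A]
variable (d : ι → Derivation ℝ A A) {g gi : Matrix ι ι A}

variable (g gi) in
/-- The Levi-Civita connection, `leviCivita d g gi a k b = Γᵏ_{ab}`. -/
def leviCivita (a : ι) : Matrix ι ι A := Matrix.of fun k b =>
  algebraMap ℝ A (1 / 2) * ∑ l, gi k l * (d a (g b l) + d b (g a l) - d l (g a b))

variable {d}

lemma leviCivita_torsion (hs : gᵀ = g) (a b k : ι) :
    leviCivita d g gi a k b = leviCivita d g gi b k a := by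
  have hs' (a b : ι) : g a b = g b a := congrFun (congrFun hs b) a
  simp only [leviCivita, Matrix.of_apply]
  simp only [hs' b a, add_comm]

/-- The Koszul formula: lowering the index cancels `gi`. Adding two instances leaves only `d a (g i
j)`, which is metric compatibility. -/
lemma leviCivita_lower (h1 : g * gi = 1) (a b k : ι) :
    ∑ m, g k m * leviCivita d g gi a m b
      = algebraMap ℝ A (1 / 2) * (d a (g b k) + d b (g a k) - d k (g a b)) := by
  have e : ∑ m, g k m * leviCivita d g gi a m b = algebraMap ℝ A (1 / 2) *
      ((g * gi) *ᵥ fun l => d a (g b l) + d b (g a l) - d l (g a b)) k := by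
    rw [← mulVec_mulVec, Matrix.mulVec, dotProduct, Finset.mul_sum]
    refine Finset.sum_congr rfl fun m _ => ?_
    simp only [leviCivita, Matrix.of_apply, Matrix.mulVec, dotProduct]
    ring
  rw [e, h1, one_mulVec]

lemma leviCivita_metric (h1 : g * gi = 1) (hs : gᵀ = g) (a : ι) :
    cov2 d (leviCivita d g gi) g a = 0 := by
  have hs' (a b : ι) : g a b = g b a := congrFun (congrFun hs b) a
  have e5 := map_mul (algebraMap ℝ A) 2 (1 / 2)
  rw [mul_one_div_cancel two_ne_zero, map_one, map_ofNat] at e5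
  ext i j
  have q1 := leviCivita_lower (d := d) h1 a i j
  have q2 := leviCivita_lower (d := d) h1 a j i
  rw [cov2_apply, Matrix.zero_apply]
  simp only [mul_comm (leviCivita d g gi a _ _)]
  simp only [fun m => hs' m j]
  rw [q1, q2, hs' j i]
  linear_combination (d a (g i j)) * e5

end Formal

/-! ## The algebra of smooth functions on an open set -/

section SmoothFunctions

open TopologicalSpace

variable {n : ℕ} (U : Opens (EuclideanSpace ℝ (Fin n)))

/-- The algebra of smooth functions on an open subset of `ℝⁿ`. -/
def smoothAlg : Subalgebra ℝ (U → ℝ) where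
  carrier := {u | ∃ v : EuclideanSpace ℝ (Fin n) → ℝ, ContDiffOn ℝ ∞ v U ∧ ∀ y : U, v y = u y}
  mul_mem' := by
    rintro _ _ ⟨v, hv, h⟩ ⟨w, hw, k⟩
    exact ⟨_, hv.mul hw, fun y => by simp [h, k]⟩
  add_mem' := by
    rintro _ _ ⟨v, hv, h⟩ ⟨w, hw, k⟩
    exact ⟨_, hv.add hw, fun y => by simp [h, k]⟩
  algebraMap_mem' c := ⟨fun _ => c, contDiffOn_const, fun _ => rfl⟩

variable {U}

/-- `Rep u a` says that the function `u` agrees on `U` with the smooth function `a`. -/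
def Rep (u : EuclideanSpace ℝ (Fin n) → ℝ) (a : smoothAlg U) : Prop :=
  ∀ y : U, u y = a.1 y

lemma Rep.contDiffOn {u : EuclideanSpace ℝ (Fin n) → ℝ} {a : smoothAlg U} (h : Rep u a) :
    ContDiffOn ℝ ∞ u U := by
  obtain ⟨v, hv, k⟩ := a.2
  exact hv.congr fun y hy => (h ⟨y, hy⟩).trans (k ⟨y, hy⟩).symm

lemma exists_rep {u : EuclideanSpace ℝ (Fin n) → ℝ} (h : ContDiffOn ℝ ∞ u U) :
    ∃ a : smoothAlg U, Rep u a :=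
  ⟨⟨fun y => u y, u, h, fun _ => rfl⟩, fun _ => rfl⟩

lemma Rep.differentiableAt {u : EuclideanSpace ℝ (Fin n) → ℝ} {a : smoothAlg U} (h : Rep u a)
    (y : U) : DifferentiableAt ℝ u y :=
  (h.contDiffOn.contDiffAt (U.isOpen.mem_nhds y.2)).differentiableAt (by simp)

/-- A derivative at a point of the open set `U` depends only on the germ. Hence `pdAlg` does not
depend on the extension chosen by `extendFun`. -/
lemma pd_congr {u v : EuclideanSpace ℝ (Fin n) → ℝ} (h : ∀ y : U, u y = v y) (i : Fin n) (y : U) :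
    pd i u y = pd i v y := by
  have : u =ᶠ[nhds (y : EuclideanSpace ℝ (Fin n))] v := by
    filter_upwards [U.isOpen.mem_nhds y.2] with z hz using h ⟨z, hz⟩
  rw [pd, pd, this.fderiv_eq]

lemma contDiffOn_pd {u : EuclideanSpace ℝ (Fin n) → ℝ} (h : ContDiffOn ℝ ∞ u U) (i : Fin n) :
    ContDiffOn ℝ ∞ (pd i u) U :=
  (h.fderiv_of_isOpen U.isOpen (by simp)).clm_apply contDiffOn_const

/-- A chosen function on `ℝⁿ` restricting to a smooth function on `U`. -/
def extendFun (a : smoothAlg U) : EuclideanSpace ℝ (Fin n) → ℝ := a.2.choose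

lemma rep_extendFun (a : smoothAlg U) : Rep (extendFun a) a := a.2.choose_spec.2

lemma pd_add {u v : EuclideanSpace ℝ (Fin n) → ℝ} {y : EuclideanSpace ℝ (Fin n)} (i : Fin n)
    (hu : DifferentiableAt ℝ u y) (hv : DifferentiableAt ℝ v y) :
    pd i (u + v) y = pd i u y + pd i v y := by
  simp [pd, fderiv_add hu hv]

lemma pd_mul {u v : EuclideanSpace ℝ (Fin n) → ℝ} {y : EuclideanSpace ℝ (Fin n)} (i : Fin n)
    (hu : DifferentiableAt ℝ u y) (hv : DifferentiableAt ℝ v y) :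
    pd i (u * v) y = u y * pd i v y + v y * pd i u y := by
  simp [pd, fderiv_mul hu hv]

lemma pd_const_smul {u : EuclideanSpace ℝ (Fin n) → ℝ} {y : EuclideanSpace ℝ (Fin n)} (i : Fin n)
    (c : ℝ) (hu : DifferentiableAt ℝ u y) : pd i (c • u) y = c * pd i u y := by
  simp [pd, fderiv_const_smul hu]

lemma pd_comm {u : EuclideanSpace ℝ (Fin n) → ℝ} (hu : ContDiffOn ℝ ∞ u U) (i j : Fin n) (y : U) :
    pd i (pd j u) y = pd j (pd i u) y := by
  have hc : ContDiffAt ℝ ∞ u (y : EuclideanSpace ℝ (Fin n)) :=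
    hu.contDiffAt (U.isOpen.mem_nhds y.2)
  have hd : DifferentiableAt ℝ (fderiv ℝ u) (y : EuclideanSpace ℝ (Fin n)) :=
    (((hu.fderiv_of_isOpen U.isOpen (m := ∞) (by simp)).contDiffAt
      (U.isOpen.mem_nhds y.2)).differentiableAt (by simp))
  have hsymm : IsSymmSndFDerivAt ℝ u (y : EuclideanSpace ℝ (Fin n)) :=
    hc.isSymmSndFDerivAt (by
    simpa using (WithTop.coe_le_coe.2 le_top : ((2 : ℕ∞) : WithTop ℕ∞) ≤ ((⊤ : ℕ∞) : WithTop ℕ∞)))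
  have e (i j : Fin n) : pd i (pd j u) y = fderiv ℝ (fderiv ℝ u) y
      (EuclideanSpace.single i 1) (EuclideanSpace.single j 1) := by
    unfold pd
    rw [fderiv_clm_apply hd (differentiableAt_const _)]
    simp
  rw [e, e, hsymm.eq]

variable (U) in
/-- The partial derivative as a derivation of the algebra of smooth functions. -/
def pdAlg (i : Fin n) : Derivation ℝ (smoothAlg U) (smoothAlg U) :=
  Derivation.mk'
    { toFun := fun a => ⟨fun y => pd i (extendFun a) y, pd i (extendFun a),
        contDiffOn_pd (rep_extendFun a).contDiffOn i, fun _ => rfl⟩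
      map_add' := fun a b => by
        ext y
        have e := pd_congr (U := U) (u := extendFun (a + b)) (v := extendFun a + extendFun b)
          (fun y => by
          rw [rep_extendFun, Pi.add_apply, rep_extendFun, rep_extendFun]; rfl) i y
        exact e.trans (pd_add i ((rep_extendFun a).differentiableAt y)
          ((rep_extendFun b).differentiableAt y))
      map_smul' := fun c a => by
        ext y
        have e := pd_congr (U := U) (u := extendFun (c • a)) (v := c • extendFun a) (fun y => by
          rw [rep_extendFun, Pi.smul_apply, rep_extendFun]; rfl) i y
        exact e.trans (pd_const_smul i c ((rep_extendFun a).differentiableAt y)) }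
    (fun a b => by
        ext y
        have e := pd_congr (U := U) (u := extendFun (a * b)) (v := extendFun a * extendFun b)
          (fun y => by
          rw [rep_extendFun, Pi.mul_apply, rep_extendFun, rep_extendFun]; rfl) i y
        have e2 := pd_mul i ((rep_extendFun a).differentiableAt y)
          ((rep_extendFun b).differentiableAt y)
        rw [rep_extendFun, rep_extendFun] at e2
        exact e.trans e2)

lemma Rep.pd {u : EuclideanSpace ℝ (Fin n) → ℝ} {a : smoothAlg U} (h : Rep u a) (i : Fin n) :
    Rep (RicciSoliton.pd i u) (pdAlg U i a) :=
  pd_congr (fun y => (h y).trans (rep_extendFun a y).symm) i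

lemma pdAlg_comm (i j : Fin n) (a : smoothAlg U) :
    pdAlg U i (pdAlg U j a) = pdAlg U j (pdAlg U i a) := by
  ext y
  have h := rep_extendFun a
  rw [← (h.pd j).pd i y, ← (h.pd i).pd j y, pd_comm h.contDiffOn]

/-- Evaluation at a point of `U`. -/
def evalAt (y : U) : smoothAlg U →+* ℝ := (Pi.evalRingHom (fun _ : U => ℝ) y).comp
  (smoothAlg U).val.toRingHom

lemma Rep.apply {u : EuclideanSpace ℝ (Fin n) → ℝ} {a : smoothAlg U} (h : Rep u a) (y : U) :
    u y = evalAt y a := h y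

lemma rep_iff {u : EuclideanSpace ℝ (Fin n) → ℝ} {a : smoothAlg U} :
    Rep u a ↔ ∀ y : U, u y = evalAt y a := Iff.rfl

lemma Rep.eq {u v : EuclideanSpace ℝ (Fin n) → ℝ} {a b : smoothAlg U} (hu : Rep u a)
    (hv : Rep v b) (h : ∀ y ∈ U, u y = v y) : a = b := by
  ext y
  rw [← hu y, ← hv y, h y y.2]

lemma evalAt_algebraMap (y : U) (c : ℝ) : evalAt y (algebraMap ℝ (smoothAlg U) c) = c := rfl

/-- The pointwise reciprocal is smooth. Applied to the determinant of the metric, this makes the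
matrix invertible over the algebra. -/
lemma isUnit_of_evalAt_ne_zero (a : smoothAlg U) (h : ∀ y : U, evalAt y a ≠ 0) : IsUnit a := by
  have hr := rep_extendFun a
  obtain ⟨b, hb⟩ := exists_rep (u := fun y => (extendFun a y)⁻¹)
    (hr.contDiffOn.inv fun y hy => by rw [hr.apply ⟨y, hy⟩]; exact h ⟨y, hy⟩)
  refine IsUnit.of_mul_eq_one b ?_
  ext y
  have h1 : b.1 y = (a.1 y)⁻¹ := by rw [← hb y, ← hr y]
  change a.1 y * b.1 y = 1
  rw [h1]
  exact mul_inv_cancel₀ (h y)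

end SmoothFunctions

/-! ### Agreement of the coordinate formulas with the algebraic ones. -/

section Transfer

open TopologicalSpace Formal Matrix

variable {n : ℕ} {U : Opens (EuclideanSpace ℝ (Fin n))} {G : Ten2 n}
  {g gi : Matrix (Fin n) (Fin n) (smoothAlg U)}

/-- Evaluation at a point is a ring homomorphism, and matrix inverses over ℝ are unique. -/
lemma rep_invMetric (hG : ∀ i j, Rep (G i j) (g i j)) (h1 : g * gi = 1) (i j : Fin n) :
    Rep (invMetric G i j) (gi i j) := by
  intro y
  have e : (Matrix.of fun a b : Fin n => G a b y) = g.map (evalAt y) := by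
    ext a b; exact hG a b y
  have e2 : g.map (evalAt y) * gi.map (evalAt y) = 1 := by
    rw [← Matrix.map_mul, h1, Matrix.map_one _ (map_zero _) (map_one _)]
  rw [invMetric, e, Matrix.inv_eq_right_inv e2]
  rfl

lemma rep_christoffel (hG : ∀ i j, Rep (G i j) (g i j)) (h1 : g * gi = 1) (k i j : Fin n) :
    Rep (christoffel G k i j) (leviCivita (pdAlg U) g gi i k j) := by
  refine rep_iff.mpr fun y => ?_
  simp only [christoffel, leviCivita, Matrix.of_apply, map_mul, map_sum, map_sub, map_add,
    evalAt_algebraMap, fun i j => (rep_invMetric hG h1 i j).apply y,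
    fun a i j => ((hG i j).pd a).apply y]

local notation "Γ[" g "," gi "]" => leviCivita (pdAlg U) g gi

lemma rep_curvature (hG : ∀ i j, Rep (G i j) (g i j)) (h1 : g * gi = 1) (l i j k : Fin n) :
    Rep (curvature G l i j k) (curv (pdAlg U) Γ[g, gi] i j l k) := by
  refine rep_iff.mpr fun y => ?_
  simp only [curvature, curv, Matrix.add_apply, Matrix.sub_apply, Matrix.map_apply,
    Matrix.mul_apply, map_mul, map_sum, map_sub, map_add, Finset.sum_sub_distrib,
    fun k i j => (rep_christoffel hG h1 k i j).apply y,
    fun a k i j => ((rep_christoffel hG h1 k i j).pd a).apply y]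

lemma rep_ricci (hG : ∀ i j, Rep (G i j) (g i j)) (h1 : g * gi = 1) (i j : Fin n) :
    Rep (ricci G i j) (ric (pdAlg U) Γ[g, gi] i j) := by
  refine rep_iff.mpr fun y => ?_
  simp only [ricci, ric, Matrix.of_apply, map_sum,
    fun l i j k => (rep_curvature hG h1 l i j k).apply y]

lemma rep_riemann (hG : ∀ i j, Rep (G i j) (g i j)) (h1 : g * gi = 1) (i j k l : Fin n) :
    Rep (riemann G i j k l) ((g * curv (pdAlg U) Γ[g, gi] i j) k l) := by
  refine rep_iff.mpr fun y => ?_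
  simp only [riemann, Matrix.mul_apply, map_sum, map_mul, fun i j => (hG i j).apply y,
    fun l i j k => (rep_curvature hG h1 l i j k).apply y]

lemma rep_covVec (hG : ∀ i j, Rep (G i j) (g i j)) (h1 : g * gi = 1) {X : Vec n}
    {V : Fin n → smoothAlg U} (hX : ∀ i, Rep (X i) (V i)) (a i : Fin n) :
    Rep (covVec G X a i) (covV (pdAlg U) Γ[g, gi] V a i) := by
  refine rep_iff.mpr fun y => ?_
  simp only [covVec, covV, Matrix.of_apply, Matrix.mulVec, dotProduct, map_sum, map_mul, map_add,
    fun i => (hX i).apply y, fun a i => ((hX i).pd a).apply y,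
    fun k i j => (rep_christoffel hG h1 k i j).apply y]

lemma rep_covTen11 (hG : ∀ i j, Rep (G i j) (g i j)) (h1 : g * gi = 1) {T : Ten2 n}
    {B : Matrix (Fin n) (Fin n) (smoothAlg U)} (hT : ∀ i j, Rep (T i j) (B i j))
    (b a i : Fin n) :
    Rep (covTen11 G T b a i) (cov11 (pdAlg U) Γ[g, gi] B b a i) := by
  refine rep_iff.mpr fun y => ?_
  simp only [covTen11, cov11, Matrix.add_apply, Matrix.sub_apply, Matrix.map_apply,
    Matrix.mul_apply, Matrix.transpose_apply, map_sum, map_mul, map_add, map_sub,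
    fun i j => (hT i j).apply y, fun a i j => ((hT i j).pd a).apply y,
    fun k i j => (rep_christoffel hG h1 k i j).apply y]
  simp only [mul_comm]

lemma rep_covTen2 (hG : ∀ i j, Rep (G i j) (g i j)) (h1 : g * gi = 1) {T : Ten2 n}
    {B : Matrix (Fin n) (Fin n) (smoothAlg U)} (hT : ∀ i j, Rep (T i j) (B i j))
    (a i j : Fin n) :
    Rep (covTen2 G T a i j) (cov2 (pdAlg U) Γ[g, gi] B a i j) := by
  refine rep_iff.mpr fun y => ?_
  simp only [covTen2, cov2_apply, map_sum, map_mul, map_sub,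
    fun i j => (hT i j).apply y, fun a i j => ((hT i j).pd a).apply y,
    fun k i j => (rep_christoffel hG h1 k i j).apply y]

lemma rep_covTen3 (hG : ∀ i j, Rep (G i j) (g i j)) (h1 : g * gi = 1) {T : Ten3 n}
    {B : Fin n → Matrix (Fin n) (Fin n) (smoothAlg U)}
    (hT : ∀ a i j, Rep (T a i j) (B a i j)) (b a i j : Fin n) :
    Rep (covTen3 G T b a i j) (cov3 (pdAlg U) Γ[g, gi] B b a i j) := by
  refine rep_iff.mpr fun y => ?_
  simp only [covTen3, cov3_apply, map_sum, map_mul, map_sub,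
    fun a i j => (hT a i j).apply y, fun b a i j => ((hT a i j).pd b).apply y,
    fun k i j => (rep_christoffel hG h1 k i j).apply y]

lemma rep_laplaceTen2 (hG : ∀ i j, Rep (G i j) (g i j)) (h1 : g * gi = 1) {T : Ten2 n}
    {B : Matrix (Fin n) (Fin n) (smoothAlg U)} (hT : ∀ i j, Rep (T i j) (B i j))
    (i j : Fin n) :
    Rep (laplaceTen2 G T i j) (lap2 (pdAlg U) Γ[g, gi] gi B i j) := by
  refine rep_iff.mpr fun y => ?_
  simp only [laplaceTen2, lap2, Matrix.sum_apply, Matrix.smul_apply, smul_eq_mul, map_sum, map_mul,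
    fun i j => (rep_invMetric hG h1 i j).apply y,
    fun b a i j => (rep_covTen3 hG h1 (rep_covTen2 hG h1 hT) b a i j).apply y]

lemma rep_laplaceVec (hG : ∀ i j, Rep (G i j) (g i j)) (h1 : g * gi = 1) {X : Vec n}
    {V : Fin n → smoothAlg U} (hX : ∀ i, Rep (X i) (V i)) (i : Fin n) :
    Rep (laplaceVec G X i) (lapV (pdAlg U) Γ[g, gi] gi V i) := by
  refine rep_iff.mpr fun y => ?_
  simp only [laplaceVec, lapV, map_sum, map_mul, fun i j => (rep_invMetric hG h1 i j).apply y,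
    fun b a i => (rep_covTen11 hG h1 (rep_covVec hG h1 hX) b a i).apply y]

lemma rep_covAlong (hG : ∀ i j, Rep (G i j) (g i j)) (h1 : g * gi = 1) {W X : Vec n}
    {S V : Fin n → smoothAlg U} (hW : ∀ i, Rep (W i) (S i)) (hX : ∀ i, Rep (X i) (V i))
    (i : Fin n) : Rep (covAlong G W X i) ((S ᵥ* covV (pdAlg U) Γ[g, gi] V) i) := by
  refine rep_iff.mpr fun y => ?_
  simp only [covAlong, Matrix.vecMul, dotProduct, map_sum, map_mul, fun i => (hW i).apply y,
    fun a i => (rep_covVec hG h1 hX a i).apply y]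

lemma rep_lieDeriv {X : Vec n} {V : Fin n → smoothAlg U} (hX : ∀ i, Rep (X i) (V i)) {T : Ten2 n}
    {B : Matrix (Fin n) (Fin n) (smoothAlg U)} (hT : ∀ i j, Rep (T i j) (B i j))
    (i j : Fin n) : Rep (lieDeriv X T i j) (lie (pdAlg U) V B i j) := by
  refine rep_iff.mpr fun y => ?_
  simp only [lieDeriv, lie, Matrix.of_apply, map_sum, map_mul, map_add,
    fun i j => (hT i j).apply y, fun a i j => ((hT i j).pd a).apply y,
    fun i => (hX i).apply y, fun a i => ((hX i).pd a).apply y]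

lemma rep_grad (hG : ∀ i j, Rep (G i j) (g i j)) (h1 : g * gi = 1)
    {u : EuclideanSpace ℝ (Fin n) → ℝ} {a : smoothAlg U} (hu : Rep u a) (i : Fin n) :
    Rep (grad G u i) ((gi *ᵥ fun j => pdAlg U j a) i) := by
  refine rep_iff.mpr fun y => ?_
  simp only [grad, Matrix.mulVec, dotProduct, map_sum, map_mul,
    fun i j => (rep_invMetric hG h1 i j).apply y, fun a => (hu.pd a).apply y]

lemma rep_lichnerowicz (hG : ∀ i j, Rep (G i j) (g i j)) (h1 : g * gi = 1) {T : Ten2 n}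
    {B : Matrix (Fin n) (Fin n) (smoothAlg U)} (hT : ∀ i j, Rep (T i j) (B i j))
    (i k : Fin n) :
    Rep (lichnerowicz G T i k) (lich (pdAlg U) Γ[g, gi] g gi B i k) := by
  refine rep_iff.mpr fun y => ?_
  have e1 : (ric (pdAlg U) Γ[g, gi] * gi * B) i k
      = ∑ a, ∑ b, ric (pdAlg U) Γ[g, gi] i a * gi a b * B b k := by
    simp only [Matrix.mul_apply, Finset.sum_mul]
    rw [Finset.sum_comm]
  have e2 : (B * (ric (pdAlg U) Γ[g, gi] * gi)ᵀ) i k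
      = ∑ a, ∑ b, ric (pdAlg U) Γ[g, gi] k a * gi a b * B i b := by
    simp only [Matrix.mul_apply, Matrix.transpose_apply, Finset.mul_sum]
    rw [Finset.sum_comm]
    simp only [mul_comm]
  simp only [lichnerowicz, lich, Matrix.add_apply, Matrix.sub_apply, e1, e2, Matrix.smul_apply,
    smul_eq_mul, curvTerm, Matrix.of_apply, map_sum, map_mul, map_add, map_sub, map_ofNat,
    fun i j => (rep_invMetric hG h1 i j).apply y, fun i j => (hT i j).apply y,
    fun i j k l => (rep_riemann hG h1 i j k l).apply y, fun i j => (rep_ricci hG h1 i j).apply y,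
    fun i j => (rep_laplaceTen2 hG h1 hT i j).apply y]

/-- The soliton identities in coordinates, for a metric represented by an invertible matrix. -/
lemma coordinate_identities_of_rep (hG : ∀ i j, Rep (G i j) (g i j)) (h1 : g * gi = 1)
    (h2 : gi * g = 1) (hs : gᵀ = g) {u : EuclideanSpace ℝ (Fin n) → ℝ} {f : smoothAlg U}
    (hf : Rep u f)
    (hsol : ∀ y ∈ U, ∀ i j, 2 * ricci G i j y + G i j y = lieDeriv (grad G u) G i j y) (y : U) :
    (∀ i, laplaceVec G (grad G u) i y + covAlong G (grad G u) (grad G u) i y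
        - (1 / 2 : ℝ) * grad G u i y = 0) ∧
      ∀ i k, lichnerowicz G (fun i j y => 2 * ricci G i j y + G i j y) i k y
        + lieDeriv (grad G u) (fun i j y => 2 * ricci G i j y + G i j y) i k y
        - (2 * ricci G i k y + G i k y) = 0 := by
  have hX := rep_grad hG h1 hf
  have hT (i j : Fin n) : Rep ((fun i j y => 2 * ricci G i j y + G i j y : Ten2 n) i j)
      ((ric (pdAlg U) Γ[g, gi] + ric (pdAlg U) Γ[g, gi] + g) i j) := by
    refine rep_iff.mpr fun z => ?_
    simp only [Matrix.add_apply, map_add, (rep_ricci hG h1 i j).apply z, (hG i j).apply z]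
    ring
  -- The soliton equation is used on all of `U`, not just at `y`, because it is differentiated.
  have hsolA : ric (pdAlg U) Γ[g, gi] + ric (pdAlg U) Γ[g, gi] + g
      = lie (pdAlg U) (gi *ᵥ fun i => pdAlg U i f) g := by
    ext1 i j
    exact (hT i j).eq (rep_lieDeriv hX hG i j) fun z hz => hsol z hz i j
  have identities := soliton_identities (d := pdAlg U) (Γ := Γ[g, gi]) (g := g) (gi := gi)
    pdAlg_comm (leviCivita_torsion (d := pdAlg U) hs) h1 h2 hs
  have parallel := leviCivita_metric (d := pdAlg U) h1 hs
  obtain ⟨r1, r2⟩ := identities parallel f hsolA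
  refine ⟨fun i => ?_, fun i k => ?_⟩
  · have e := congrArg (evalAt y) (congrFun r1 i)
    rw [(rep_laplaceVec hG h1 hX i).apply y, (rep_covAlong hG h1 hX hX i).apply y,
      (hX i).apply y]
    simp only [Pi.add_apply, Pi.sub_apply, Pi.smul_apply, map_add, map_sub, Pi.zero_apply,
      map_zero] at e
    simpa only [Algebra.smul_def, map_mul, evalAt_algebraMap] using e
  · have e := congrArg (evalAt y) (congrFun (congrFun r2 i) k)
    have e1 := (rep_lichnerowicz hG h1 hT i k).apply y
    have e2 := (rep_lieDeriv hX hT i k).apply y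
    have e3 := (hT i k).apply y
    rw [Matrix.sub_apply, map_sub, Matrix.add_apply, map_add, ← e1, ← e2, ← e3,
      Matrix.zero_apply, map_zero] at e
    exact e

/-- The soliton identities in coordinates. -/
theorem coordinate_identities (hsm : ∀ i j, ContDiffOn ℝ ∞ (G i j) U)
    (hsymm : ∀ i j, ∀ y ∈ U, G i j y = G j i y)
    (hdet : ∀ y ∈ U, (Matrix.of fun a b : Fin n => G a b y).det ≠ 0)
    {u : EuclideanSpace ℝ (Fin n) → ℝ} (hu : ContDiffOn ℝ ∞ u U)
    (hsol : ∀ y ∈ U, ∀ i j, 2 * ricci G i j y + G i j y = lieDeriv (grad G u) G i j y)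
    (y : EuclideanSpace ℝ (Fin n)) (hy : y ∈ U) :
    (∀ i, laplaceVec G (grad G u) i y + covAlong G (grad G u) (grad G u) i y
        - (1 / 2 : ℝ) * grad G u i y = 0) ∧
      ∀ i k, lichnerowicz G (fun i j y => 2 * ricci G i j y + G i j y) i k y
        + lieDeriv (grad G u) (fun i j y => 2 * ricci G i j y + G i j y) i k y
        - (2 * ricci G i k y + G i k y) = 0 := by
  choose γ hγ using fun i j => exists_rep (hsm i j)
  obtain ⟨f, hf⟩ := exists_rep hu
  obtain ⟨g, hG⟩ : ∃ g : Matrix (Fin n) (Fin n) (smoothAlg U), ∀ i j, Rep (G i j) (g i j) :=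
    ⟨Matrix.of γ, hγ⟩
  have hdetU : IsUnit g.det := by
    refine isUnit_of_evalAt_ne_zero _ fun z => ?_
    rw [RingHom.map_det]
    have e : (evalAt z).mapMatrix g = Matrix.of fun a b : Fin n => G a b z := by
      ext a b; exact ((hG a b).apply z).symm
    rw [e]
    exact hdet z z.2
  have hs : gᵀ = g := by
    ext1 i j
    exact (hG j i).eq (hG i j) (hsymm j i)
  exact coordinate_identities_of_rep hG (Matrix.mul_nonsing_inv g hdetU)
    (Matrix.nonsing_inv_mul g hdetU) hs hf hsol ⟨y, hy⟩

end Transfer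

/-! ### Smoothness and nondegeneracy of the metric components in a chart. -/

section Charts

variable {n : ℕ} {M : Type*} [TopologicalSpace M] [ChartedSpace (EuclideanSpace ℝ (Fin n)) M]
  [IsManifold (𝓡 n) ∞ M]
  (g : Bundle.ContMDiffRiemannianMetric (𝓡 n) ∞ (EuclideanSpace ℝ (Fin n))
      (fun x : M => TangentSpace (𝓡 n) x))
  {φ : OpenPartialHomeomorph M (EuclideanSpace ℝ (Fin n))}

/-- The coordinate field is the tangent map of the inverse chart applied to a constant section. -/
lemma contMDiffOn_coordVec (hφ : φ ∈ IsManifold.maximalAtlas (𝓡 n) ∞ M) (i : Fin n) :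
    ContMDiffOn (𝓡 n) ((𝓡 n).prod 𝓘(ℝ, EuclideanSpace ℝ (Fin n))) ∞
      (fun y => Bundle.TotalSpace.mk' (EuclideanSpace ℝ (Fin n)) (E := fun x : M =>
        TangentSpace (𝓡 n) x) (φ.symm y) (coordVec φ i y)) φ.target := by
  have h := (contMDiffOn_symm_of_mem_maximalAtlas hφ).contMDiffOn_tangentMapWithin (m := ∞)
    (by simp) φ.open_target.uniqueMDiffOn
  have hs : ContMDiff (𝓡 n) ((𝓡 n).prod 𝓘(ℝ, EuclideanSpace ℝ (Fin n))) ∞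
      (fun y : EuclideanSpace ℝ (Fin n) => (⟨y, EuclideanSpace.single i (1 : ℝ)⟩ :
        TangentBundle (𝓡 n) (EuclideanSpace ℝ (Fin n)))) := by
    intro y
    rw [Bundle.contMDiffAt_totalSpace]
    refine ⟨contMDiffAt_id, ?_⟩
    simp
    exact contMDiffAt_const
  refine (h.comp hs.contMDiffOn fun y hy => hy).congr fun y hy => ?_
  simp only [Function.comp, tangentMapWithin, coordVec]
  rw [mfderivWithin_of_isOpen φ.open_target hy]

lemma contDiffOn_metricIn (hφ : φ ∈ IsManifold.maximalAtlas (𝓡 n) ∞ M) (i j : Fin n) :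
    ContDiffOn ℝ ∞ (metricIn g φ i j) φ.target := by
  rw [← contMDiffOn_iff_contDiffOn]
  have h : ContMDiffOn (𝓡 n) ((𝓡 n).prod 𝓘(ℝ, ℝ)) ∞
      (fun y => Bundle.TotalSpace.mk' ℝ (E := Bundle.Trivial M ℝ) (φ.symm y)
        (metricIn g φ i j y)) φ.target :=
    ContMDiffOn.clm_bundle_apply₂ (F₁ := EuclideanSpace ℝ (Fin n))
      (F₂ := EuclideanSpace ℝ (Fin n))
      (g.contMDiff.comp_contMDiffOn (contMDiffOn_symm_of_mem_maximalAtlas hφ))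
      (contMDiffOn_coordVec hφ i) (contMDiffOn_coordVec hφ j)
  intro y hy
  have h2 := h y hy
  rw [Bundle.contMDiffWithinAt_totalSpace] at h2
  exact h2.2

lemma linearIndependent_coordVec (hφ : φ ∈ IsManifold.maximalAtlas (𝓡 n) ∞ M)
    {y : EuclideanSpace ℝ (Fin n)} (hy : y ∈ φ.target) (c : Fin n → ℝ)
    (h : ∑ i, c i • coordVec φ i y = 0) : c = 0 := by
  have hd : φ.MDifferentiable (𝓡 n) (𝓡 n) :=
    ⟨(contMDiffOn_of_mem_maximalAtlas hφ).mdifferentiableOn (by simp),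
      (contMDiffOn_symm_of_mem_maximalAtlas hφ).mdifferentiableOn (by simp)⟩
  have hinj := (hd.symm.mfderiv_bijective (x := y) hy).1
  have e : mfderiv (𝓡 n) (𝓡 n) φ.symm y
      (∑ i, c i • (EuclideanSpace.single i (1 : ℝ) : EuclideanSpace ℝ (Fin n))) = 0 := by
    rw [← h]
    exact (map_sum _ _ _).trans (Finset.sum_congr rfl fun i _ => map_smul _ _ _)
  have e2 : ∑ i, c i • (EuclideanSpace.single i (1 : ℝ) : EuclideanSpace ℝ (Fin n)) = 0 :=
    hinj (e.trans (map_zero _).symm)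
  ext j
  have e3 := congrArg (fun v : EuclideanSpace ℝ (Fin n) => v j) e2
  simpa [Pi.single_apply] using e3

/-- A kernel vector `c` of the Gram matrix gives v = ∑ cᵢ ∂ᵢ with g(v, v) = 0, so v = 0 by
positivity and `c = 0` by independence of the coordinate fields. -/
lemma det_metricIn_ne_zero (hφ : φ ∈ IsManifold.maximalAtlas (𝓡 n) ∞ M)
    {y : EuclideanSpace ℝ (Fin n)} (hy : y ∈ φ.target) :
    (Matrix.of fun a b : Fin n => metricIn g φ a b y).det ≠ 0 := by
  intro h0
  obtain ⟨c, hc, hz⟩ := Matrix.exists_mulVec_eq_zero_iff.mpr h0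
  refine hc (linearIndependent_coordVec hφ hy c ?_)
  by_contra hv
  refine (g.pos _ _ hv).ne' ?_
  rw [map_sum]
  refine Finset.sum_eq_zero fun a _ => ?_
  have := congrFun hz a
  simp only [Matrix.mulVec, dotProduct, Matrix.of_apply, Pi.zero_apply, metricIn] at this
  rw [map_smul, g.symm, map_sum]
  simp only [map_smul, smul_eq_mul]
  rw [← mul_zero (c a), ← this]
  simp only [mul_comm]

end Charts

end RicciSoliton

end

theorem corollary3p2 {n : ℕ} {M : Type*} [TopologicalSpace M]
    [ChartedSpace (EuclideanSpace ℝ (Fin n)) M] [IsManifold (𝓡 n) ∞ M]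
    (g : Bundle.ContMDiffRiemannianMetric (𝓡 n) ∞ (EuclideanSpace ℝ (Fin n))
      (fun x : M => TangentSpace (𝓡 n) x))
    (f : M → ℝ) (hsol : RicciSoliton.IsExpandingGradientSoliton g f) :
    (∀ φ ∈ IsManifold.maximalAtlas (𝓡 n) ∞ M, ∀ y ∈ φ.target, ∀ i : Fin n,
      RicciSoliton.laplaceVec (RicciSoliton.metricIn g φ) (RicciSoliton.gradIn g f φ) i y
        + RicciSoliton.covAlong (RicciSoliton.metricIn g φ)
            (RicciSoliton.gradIn g f φ) (RicciSoliton.gradIn g f φ) i y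
        - (1 / 2 : ℝ) * RicciSoliton.gradIn g f φ i y = 0) ∧
    (∀ φ ∈ IsManifold.maximalAtlas (𝓡 n) ∞ M, ∀ y ∈ φ.target, ∀ i k : Fin n,
      RicciSoliton.lichnerowicz (RicciSoliton.metricIn g φ)
          (RicciSoliton.twoRicAddMetricIn g φ) i k y
        + RicciSoliton.lieDeriv (RicciSoliton.gradIn g f φ)
            (RicciSoliton.twoRicAddMetricIn g φ) i k y
        - RicciSoliton.twoRicAddMetricIn g φ i k y = 0) := by
  have key (φ) (hφ : φ ∈ IsManifold.maximalAtlas (𝓡 n) ∞ M) :=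
    RicciSoliton.coordinate_identities (U := ⟨φ.target, φ.open_target⟩)
      (G := RicciSoliton.metricIn g φ) (u := f ∘ φ.symm)
      (RicciSoliton.contDiffOn_metricIn g hφ)
      (fun i j y _ => g.symm _ _ _)
      (fun y hy => RicciSoliton.det_metricIn_ne_zero g hφ hy)
      (contMDiffOn_iff_contDiffOn.mp
        (hsol.smooth.comp_contMDiffOn (contMDiffOn_symm_of_mem_maximalAtlas hφ)))
      (fun y hy i j => hsol.soliton_eq φ hφ y hy i j)
  exact ⟨fun φ hφ y hy => (key φ hφ y hy).1, fun φ hφ y hy => (key φ hφ y hy).2⟩
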